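/- **Theorem (Completeness for Programs).** Let $\Theta$ be a signature containing $0,1$ (arity $0$) and $+,\dot-$ (arity $2$), and let $\mathcal E$ be an equational program over $\Theta$ (a set of equations between index terms) with a semantics that interprets the symbols of $\Theta$ by partial functions on $\mathbb N$, interprets $0,1,+,\dot-$ as usual, and satisfies every equation of $\mathcal E$ (each side is defined iff the other is, and then the values agree). Assume $\mathcal E$ is *universal*: every partial recursive function $\mathbb N^k\rightharpoonup\mathbb N$ is the meaning of an index term with $k$ free variables. Let $t$ be a closed term with $\vdash t:\mathsf{Nat}$ in PCF, and suppose that $t$ evaluates to the numeral $\underline m$ in $n$ steps of the CEK machine. Then there is $k\le n$ such that $$\emptyset;\emptyset;\emptyset\vdash^{\mathcal E}_{\overline k}\,t:\mathsf{Nat}[\overline m,\overline m]$$ is derivable in $\mathsf{d}\ell\mathsf{PCF_V}$, i.e. $t$ has type $\mathsf{Nat}[\overline m]$ with weight $\overline k$. The notions used are the following. *PCF.* Values are $v::=\underline n\mid\lambda x.t\mid\mathsf{fix}\,x.t$; terms are $t::=x\mid v\mid t\,u\mid\mathsf s(t)\mid\mathsf p(t)\mid\mathsf{ifz}\ t\ \mathsf{then}\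 u\ \mathsf{else}\ s$. Simple types are generated by $\mathsf{Nat}$ and $\to$, with the usual rules; $\Gamma\vdash\mathsf{fix}\,x.t:\alpha\to\beta$ if $\Gamma,x:\alpha\to\beta\vdash t:\alpha\to\beta$. *CEK machine.* Environments $\xi$ are lists of assignments of closures $\langle v;\xi'\rangle$ of values to variables; states are $\langle t;\xi\rangle\star\pi$ with stacks $\pi::=\diamond\mid\mathsf{fun}(\langle v;\xi\rangle)\cdot\pi\mid\mathsf{arg}(\langle t;\xi\rangle)\cdot\pi\mid\mathsf{fork}(t,u,\xi)\cdot\pi\mid\mathsf s\cdot\pi\mid\mathsf p\cdot\pi$. For a value closure $\mathbf v$ and a closure $c$ the steps are $\mathbf v\star\mathsf{arg}(c)\cdot\pi\succ c\star\mathsf{fun}(\mathbf v)\cdot\pi$; $\mathbf v\star\mathsf{fun}(\langle\lambda x.t;\xi\rangle)\cdot\pi\succ\langle t;(x\mapsto\mathbf v)\cdot\xi\rangle\star\pi$; $\mathbf v\star\mathsf{fun}(\langle\mathsf{fix}\,x.t;\xi\rangle)\cdot\pi\succ\langle t;(x\mapsto\langle\mathsf{fix}\,x.t;\xi\rangle)\cdot\xi\rangle\star\mathsf{arg}(\mathbf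 v)\cdot\pi$; $\langle\underline0;\xi'\rangle\star\mathsf{fork}(t,u,\xi)\cdot\pi\succ\langle t;\xi\rangle\star\pi$; $\langle\underline{n+1};\xi'\rangle\star\mathsf{fork}(t,u,\xi)\cdot\pi\succ\langle u;\xi\rangle\star\pi$; $\langle\underline n;\xi\rangle\star\mathsf s\cdot\pi\succ\langle\underline{n+1};\emptyset\rangle\star\pi$; $\langle\underline n;\xi\rangle\star\mathsf p\cdot\pi\succ\langle\underline{n\mathbin{\dot-}1};\emptyset\rangle\star\pi$; $\langle x;\xi\rangle\star\pi\succ\xi(x)\star\pi$; $\langle t\,u;\xi\rangle\star\pi\succ\langle t;\xi\rangle\star\mathsf{arg}(\langle u;\xi\rangle)\cdot\pi$; $\langle\mathsf s(t);\xi\rangle\star\pi\succ\langle t;\xi\rangle\star\mathsf s\cdot\pi$; $\langle\mathsf p(t);\xi\rangle\star\pi\succ\langle t;\xi\rangle\star\mathsf p\cdot\pi$; $\langle\mathsf{ifz}\ t\ \mathsf{then}\ u\ \mathsf{else}\ s;\xi\rangle\star\pi\succ\langle t;\xi\rangle\star\mathsf{fork}(u,s,\xi)\cdot\pi$. The term $t$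 evaluates to $\underline m$ in $n$ steps if $\langle t;\emptyset\rangle\star\diamond\succ^n\langle\underline m;\xi\rangle\star\diamond$ for some $\xi$. *Index terms.* $I,J,K::=a\mid f(I_1,\dots,I_r)\mid\sum_{a<I}J\mid\bigotimes_a^{I,J}K$ with $f\in\Theta$; $a$ is bound in $J$, respectively in $K$. They denote partially defined natural numbers: function symbols are applied strictly; $\sum_{a<I}J$ sums the values of $J$ for $a=0,\dots,I-1$; and the forest cardinality $\bigotimes_a^{I,J}K$ is the least solution of $\bigotimes_a^{I,0}K=0$ and $\bigotimes_a^{I,J+1}K=N+1+\bigotimes_a^{I+1+N,\;K\{I+N/a\}}K$ with $N=\bigotimes_a^{I,J}K$. For $n\in\mathbb N$, $\overline n$ is $1+\dots+1$ ($n$ times; $\overline 0$ is $0$). Let $\phi$ be a set of index variables and $\Phi$ a finite set of constraints $I\le J$ over $\phi$ ($a<I$ means $a+1\le I$). A constraint is true under an assignment if both sides are defined and the inequality holds. $\phi;\Phi\models I\le J$ means that every assignment making all of $\Phi$ true makes $I\le J$ true. *Types.* Linear types are $A,B::=\sigma\multimap\tau$; modal types are $\sigma,\tau::=[a<I]\cdot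 A\mid\mathsf{Nat}[I,J]$, where $a$ is bound in $A$. Types are taken up to renaming of bound variables, and $\mathsf{Nat}[I]=\mathsf{Nat}[I,I]$. Partial sums are given by $[a<I]\cdot A\{a/c\}\uplus[b<J]\cdot A\{I+b/c\}=[c<I+J]\cdot A$ and $\mathsf{Nat}[I,J]\uplus\mathsf{Nat}[I,J]=\mathsf{Nat}[I,J]$; bounded sums by $\sum_{a<I}[b<J]\cdot A\{b+\sum_{d<a}J\{d/a\}/c\}=[c<\sum_{a<I}J]\cdot A$ and, for $a$ not free in $J,K$, $\sum_{a<I}\mathsf{Nat}[J,K]=\mathsf{Nat}[J,K]$. Both are extended pointwise to contexts (finite partial maps from term variables to modal types), where in $\Gamma\uplus\Delta$ a variable occurring in only one context keeps its type. Subtyping: $\mathsf{Nat}[I,J]\sqsubseteq\mathsf{Nat}[K,H]$ under $\phi;\Phi$ if $\phi;\Phi\models K\le I$ and $\phi;\Phi\models J\le H$; $\sigma\multimap\tau\sqsubseteq\sigma'\multimap\tau'$ if $\sigma'\sqsubseteq\sigma$ and $\tau\sqsubseteq\tau'$; $[a<I]\cdot A\sqsubseteq[a<J]\cdot B$ under $\phi;\Phi$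 if $A\sqsubseteq B$ under $(a,\phi);(a<J,\Phi)$ and $\phi;\Phi\models J\le I$. Context subtyping is pointwise, for contexts with the same domain. *Typing.* The judgement $\phi;\Phi;\Gamma\vdash_I t:\tau$ ($\phi$, $\Phi$ omitted when unchanged) is given by the rules: - $\Gamma,x:\sigma\vdash_0x:\sigma$, and $\Gamma\vdash_0\underline n:\mathsf{Nat}[\overline n,\overline n]$. - If $\Gamma\vdash_It:\sigma$, $\Delta\sqsubseteq\Gamma$, $\sigma\sqsubseteq\tau$ and $\phi;\Phi\models I\le J$, then $\Delta\vdash_Jt:\tau$. - If $(a,\phi);(a<I,\Phi);\Gamma,x:\sigma\vdash_Kt:\tau$, then $\sum_{a<I}\Gamma\vdash_{I+\sum_{a<I}K}\lambda x.t:[a<I]\cdot(\sigma\multimap\tau)$. - If $\Gamma\vdash_Kt:[a<1]\cdot(\sigma\multimap\tau)$ and $\Delta\vdash_Hu:\sigma\{0/a\}$, then $\Gamma\uplus\Delta\vdash_{K+H}t\,u:\tau\{0/a\}$. - If $\Gamma\vdash_Mt:\mathsf{Nat}[J,K]$, $\phi;(J\le0,\Phi);\Delta\vdash_Nu:\tau$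 and $\phi;(K\ge1,\Phi);\Delta\vdash_Ns:\tau$, then $\Gamma\uplus\Delta\vdash_{M+N}\mathsf{ifz}\ t\ \mathsf{then}\ u\ \mathsf{else}\ s:\tau$. - If $\Gamma\vdash_Mt:\mathsf{Nat}[I,J]$, then $\Gamma\vdash_M\mathsf s(t):\mathsf{Nat}[I+1,J+1]$ and $\Gamma\vdash_M\mathsf p(t):\mathsf{Nat}[I\mathbin{\dot-}1,J\mathbin{\dot-}1]$. - Let $H=\bigotimes_b^{0,K}I$. If $(b,\phi);(b<H,\Phi);\Gamma,x:[a<I]\cdot A\vdash_Jt:[a<1]\cdot B$, and $B\{0/a\}\{\bigotimes_b^{b+1,a}I+b+1/b\}\sqsubseteq A$ under $(a,b,\phi);(a<I,b<H,\Phi)$, then $\sum_{b<H}\Gamma\vdash_{H+\sum_{b<H}J}\mathsf{fix}\,x.t:[a<K]\cdot B\{0/a\}\{\bigotimes_b^{0,a}I/b\}$. -/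

import Mathlib

namespace DlPCF

universe u

/-! ## PCF: terms, simple types, the CEK machine (de Bruijn indices for term variables) -/

/-- Terms of PCF. `lam t` and `fix t` bind the variable `0` of `t`;
`ifz t u s` is "if `t` is zero then `u` else `s`". -/
inductive Term : Type
  | var (x : ℕ)
  | num (n : ℕ)
  | lam (t : Term)
  | fix (t : Term)
  | app (t u : Term)
  | succ (t : Term)
  | pred (t : Term)
  | ifz (t u s : Term)

/-- Values: numerals, abstractions, fixpoints. -/
inductive Term.IsValue : Term → Prop
  | num (n : ℕ) : IsValue (.num n)
  | lam (t : Term) : IsValue (.lam t)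
  | fix (t : Term) : IsValue (.fix t)

/-- Simple types of PCF. -/
inductive PTy : Type
  | nat
  | arr (α β : PTy)

/-- The PCF type system: the erasure of the linear dependent type system below.
In particular a fixpoint is a value of arrow type. -/
inductive PCFTyping : List PTy → Term → PTy → Prop
  | var {Γ : List PTy} {x : ℕ} {α : PTy} : Γ[x]? = some α → PCFTyping Γ (.var x) α
  | num {Γ : List PTy} (n : ℕ) : PCFTyping Γ (.num n) .nat
  | lam {Γ : List PTy} {t : Term} {α β : PTy} :
      PCFTyping (α :: Γ) t β → PCFTyping Γ (.lam t) (.arr α β)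
  | fix {Γ : List PTy} {t : Term} {α β : PTy} :
      PCFTyping (.arr α β :: Γ) t (.arr α β) → PCFTyping Γ (.fix t) (.arr α β)
  | app {Γ : List PTy} {t u : Term} {α β : PTy} :
      PCFTyping Γ t (.arr α β) → PCFTyping Γ u α → PCFTyping Γ (.app t u) β
  | succ {Γ : List PTy} {t : Term} : PCFTyping Γ t .nat → PCFTyping Γ (.succ t) .nat
  | pred {Γ : List PTy} {t : Term} : PCFTyping Γ t .nat → PCFTyping Γ (.pred t) .nat
  | ifz {Γ : List PTy} {t u s : Term} {α : PTy} :
      PCFTyping Γ t .nat → PCFTyping Γ u α → PCFTyping Γ s α → PCFTyping Γ (.ifz t u s) α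

/-- Environments: lists of closures, where `cons v ξ' ξ` stands for `⟨v; ξ'⟩ · ξ`.
The machine only ever puts closures of values there. -/
inductive Env : Type
  | empty
  | cons (v : Term) (env : Env) (rest : Env)

/-- A closure `⟨t; ξ⟩`. -/
structure Closure : Type where
  term : Term
  env : Env

/-- The closure that an environment assigns to a variable. -/
def Env.lookup : Env → ℕ → Option Closure
  | .empty, _ => none
  | .cons v env _, 0 => some ⟨v, env⟩
  | .cons _ _ rest, x + 1 => rest.lookup x

/-- Stacks of the machine. -/
inductive Stack : Type
  | nil
  | fn (v : Closure) (π : Stack)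
  | arg (c : Closure) (π : Stack)
  | fork (t u : Term) (ξ : Env) (π : Stack)
  | succ (π : Stack)
  | pred (π : Stack)

/-- A machine state `c ⋆ π`. -/
structure State : Type where
  closure : Closure
  stack : Stack

/-- One transition of the CEK machine. -/
inductive Step : State → State → Prop
  -- transitions for closures of values
  | val_arg {v : Term} {ξ : Env} {c : Closure} {π : Stack} : v.IsValue →
      Step ⟨⟨v, ξ⟩, .arg c π⟩ ⟨c, .fn ⟨v, ξ⟩ π⟩
  | val_lam {v t : Term} {ξv ξ : Env} {π : Stack} : v.IsValue →
      Step ⟨⟨v, ξv⟩, .fn ⟨.lam t, ξ⟩ π⟩ ⟨⟨t, .cons v ξv ξ⟩, π⟩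
  | val_fix {v t : Term} {ξv ξ : Env} {π : Stack} : v.IsValue →
      Step ⟨⟨v, ξv⟩, .fn ⟨.fix t, ξ⟩ π⟩ ⟨⟨t, .cons (.fix t) ξ ξ⟩, .arg ⟨v, ξv⟩ π⟩
  | zero_fork {ξv ξ : Env} {t u : Term} {π : Stack} :
      Step ⟨⟨.num 0, ξv⟩, .fork t u ξ π⟩ ⟨⟨t, ξ⟩, π⟩
  | succ_fork {n : ℕ} {ξv ξ : Env} {t u : Term} {π : Stack} :
      Step ⟨⟨.num (n + 1), ξv⟩, .fork t u ξ π⟩ ⟨⟨u, ξ⟩, π⟩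
  | num_succ {n : ℕ} {ξ : Env} {π : Stack} :
      Step ⟨⟨.num n, ξ⟩, .succ π⟩ ⟨⟨.num (n + 1), .empty⟩, π⟩
  | num_pred {n : ℕ} {ξ : Env} {π : Stack} :
      Step ⟨⟨.num n, ξ⟩, .pred π⟩ ⟨⟨.num (n - 1), .empty⟩, π⟩
  -- contextual transitions
  | var {x : ℕ} {ξ : Env} {c : Closure} {π : Stack} : ξ.lookup x = some c →
      Step ⟨⟨.var x, ξ⟩, π⟩ ⟨c, π⟩
  | app {t u : Term} {ξ : Env} {π : Stack} :
      Step ⟨⟨.app t u, ξ⟩, π⟩ ⟨⟨t, ξ⟩, .arg ⟨u, ξ⟩ π⟩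
  | succ {t : Term} {ξ : Env} {π : Stack} :
      Step ⟨⟨.succ t, ξ⟩, π⟩ ⟨⟨t, ξ⟩, .succ π⟩
  | pred {t : Term} {ξ : Env} {π : Stack} :
      Step ⟨⟨.pred t, ξ⟩, π⟩ ⟨⟨t, ξ⟩, .pred π⟩
  | ifz {t u s : Term} {ξ : Env} {π : Stack} :
      Step ⟨⟨.ifz t u s, ξ⟩, π⟩ ⟨⟨t, ξ⟩, .fork u s ξ π⟩

/-- `Steps n P Q`: the machine goes from `P` to `Q` in exactly `n` transitions. -/
inductive Steps : ℕ → State → State → Prop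
  | refl (P : State) : Steps 0 P P
  | head {n : ℕ} {P Q R : State} : Step P Q → Steps n Q R → Steps (n + 1) P R

/-- `t` evaluates to the numeral `m` in `n` machine steps. The final closure of a numeral may
still carry a (useless) environment. -/
def Term.EvalsTo (t : Term) (n m : ℕ) : Prop :=
  ∃ ξ : Env, Steps n ⟨⟨t, .empty⟩, .nil⟩ ⟨⟨.num m, ξ⟩, .nil⟩

/-! ## Index terms

`Θ n` is the type of the function symbols of arity `n` other than `0`, `1`, `+` and `∸`, which
belong to every signature and are built in. `Idx Θ k` is the type of the index terms whose free
variables are among `k` given ones (de Bruijn indices). -/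

/-- Index terms. `sum I J` is `∑_{a < I} J`, with `a` the variable `0` of `J`;
`forest I J K` is the forest cardinality with start `I`, number of trees `J` and number of
children `K`, whose variable `0` is bound. -/
inductive Idx (Θ : ℕ → Type u) : ℕ → Type u
  | var {k : ℕ} (a : Fin k) : Idx Θ k
  | zero {k : ℕ} : Idx Θ k
  | one {k : ℕ} : Idx Θ k
  | add {k : ℕ} (I J : Idx Θ k) : Idx Θ k
  | monus {k : ℕ} (I J : Idx Θ k) : Idx Θ k
  | app {k n : ℕ} (f : Θ n) (args : Fin n → Idx Θ k) : Idx Θ k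
  | sum {k : ℕ} (I : Idx Θ k) (J : Idx Θ (k + 1)) : Idx Θ k
  | forest {k : ℕ} (I J : Idx Θ k) (K : Idx Θ (k + 1)) : Idx Θ k

/-- Extension of a renaming under a binder. -/
def liftRen {k l : ℕ} (r : Fin k → Fin l) : Fin (k + 1) → Fin (l + 1) :=
  Fin.cases 0 (fun i => (r i).succ)

namespace Idx

variable {Θ : ℕ → Type u}

/-- Renaming of variables. -/
def rename : {k : ℕ} → Idx Θ k → {l : ℕ} → (Fin k → Fin l) → Idx Θ l
  | _, var a, _, r => var (r a)
  | _, zero, _, _ => zero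
  | _, one, _, _ => one
  | _, add I J, _, r => add (I.rename r) (J.rename r)
  | _, monus I J, _, r => monus (I.rename r) (J.rename r)
  | _, app f args, _, r => app f (fun i => (args i).rename r)
  | _, sum I J, _, r => sum (I.rename r) (J.rename (liftRen r))
  | _, forest I J K, _, r => forest (I.rename r) (J.rename r) (K.rename (liftRen r))

/-- The same index term, with one more variable (the new variable `0`) in scope. -/
def weaken {k : ℕ} (I : Idx Θ k) : Idx Θ (k + 1) := I.rename Fin.succ

/-- Extension of a substitution under a binder. -/
def liftSub {k l : ℕ} (s : Fin k → Idx Θ l) : Fin (k + 1) → Idx Θ (l + 1) :=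
  Fin.cases (var 0) (fun i => (s i).weaken)

/-- Simultaneous capture-avoiding substitution. -/
def subst : {k : ℕ} → Idx Θ k → {l : ℕ} → (Fin k → Idx Θ l) → Idx Θ l
  | _, var a, _, s => s a
  | _, zero, _, _ => zero
  | _, one, _, _ => one
  | _, add I J, _, s => add (I.subst s) (J.subst s)
  | _, monus I J, _, s => monus (I.subst s) (J.subst s)
  | _, app f args, _, s => app f (fun i => (args i).subst s)
  | _, sum I J, _, s => sum (I.subst s) (J.subst (liftSub s))
  | _, forest I J K, _, s => forest (I.subst s) (J.subst s) (K.subst (liftSub s))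

/-- The index term `1 + 1 + ⋯ + 1` (`n` times). -/
def numeral {k : ℕ} : ℕ → Idx Θ k
  | 0 => zero
  | 1 => one
  | n + 2 => add (numeral (n + 1)) one

end Idx

/-- `ForestCard κ i j n`: the forest of `j` trees whose nodes are numbered in pre-order from `i`
on, and in which the number of children of a node `x` is the `c` with `κ x c`, has `n` nodes.
This is the least relation given by the two recursive equations of forest cardinalities. -/
inductive ForestCard (κ : ℕ → ℕ → Prop) : ℕ → ℕ → ℕ → Prop
  | zero (i : ℕ) : ForestCard κ i 0 0
  | succ {i j n c p : ℕ} : ForestCard κ i j n → κ (i + n) c → ForestCard κ (i + 1 + n) c p →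
      ForestCard κ i (j + 1) (n + 1 + p)

/-- An interpretation of the function symbols by partial functions on the natural numbers. -/
abbrev Interp (Θ : ℕ → Type u) : Type u := (n : ℕ) → Θ n → ((Fin n → ℕ) →. ℕ)

/-- `I.HasValue φ ρ m`: the index term `I` is defined, with value `m`, under the interpretation
`φ` of the symbols and the assignment `ρ`. -/
def Idx.HasValue {Θ : ℕ → Type u} (φ : Interp Θ) :
    {k : ℕ} → Idx Θ k → (Fin k → ℕ) → ℕ → Prop
  | _, .var a, ρ, m => m = ρ a
  | _, .zero, _, m => m = 0
  | _, .one, _, m => m = 1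
  | _, .add I J, ρ, m => ∃ x y : ℕ, I.HasValue φ ρ x ∧ J.HasValue φ ρ y ∧ m = x + y
  | _, .monus I J, ρ, m => ∃ x y : ℕ, I.HasValue φ ρ x ∧ J.HasValue φ ρ y ∧ m = x - y
  | _, .app (n := n) f args, ρ, m =>
      ∃ v : Fin n → ℕ, (∀ i, (args i).HasValue φ ρ (v i)) ∧ m ∈ φ n f v
  | k, .sum I J, ρ, m => ∃ (x : ℕ) (v : ℕ → ℕ), I.HasValue φ ρ x ∧
      (∀ i < x, J.HasValue φ (Fin.cons i ρ : Fin (k + 1) → ℕ) (v i)) ∧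
      m = ∑ i ∈ Finset.range x, v i
  | k, .forest I J K, ρ, m => ∃ x y : ℕ, I.HasValue φ ρ x ∧ J.HasValue φ ρ y ∧
      ForestCard (fun i c => K.HasValue φ (Fin.cons i ρ : Fin (k + 1) → ℕ) c) x y m

/-- An equational program: a set of equations between index terms. -/
abbrev EqProgram (Θ : ℕ → Type u) : Type u := Set (Σ k : ℕ, Idx Θ k × Idx Θ k)

/-- `φ` is a semantics of the equational program: it satisfies all the equations, where a side
is defined if and only if the other one is. -/
def Interp.Models {Θ : ℕ → Type u} (φ : Interp Θ) (E : EqProgram Θ) : Prop :=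
  ∀ e ∈ E, ∀ (ρ : Fin e.1 → ℕ) (m : ℕ), e.2.1.HasValue φ ρ m ↔ e.2.2.HasValue φ ρ m

/-- Universality: every partial recursive function is expressed by an index term. -/
def Interp.Universal {Θ : ℕ → Type u} (φ : Interp Θ) : Prop :=
  ∀ (k : ℕ) (f : (Fin k → ℕ) →. ℕ), Partrec f →
    ∃ I : Idx Θ k, ∀ (ρ : Fin k → ℕ) (m : ℕ), I.HasValue φ ρ m ↔ m ∈ f ρ

/-! ## Constraints -/

/-- A constraint `lhs ≤ rhs`. -/
structure Constraint (Θ : ℕ → Type u) (k : ℕ) : Type u where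
  lhs : Idx Θ k
  rhs : Idx Θ k

section Judgements

variable {Θ : ℕ → Type u}

/-- A constraint is true if both sides are defined and the inequality holds. -/
def Constraint.Holds (φ : Interp Θ) {k : ℕ} (c : Constraint Θ k) (ρ : Fin k → ℕ) : Prop :=
  ∃ m n : ℕ, c.lhs.HasValue φ ρ m ∧ c.rhs.HasValue φ ρ n ∧ m ≤ n

def Constraint.weaken {k : ℕ} (c : Constraint Θ k) : Constraint Θ (k + 1) :=
  ⟨c.lhs.weaken, c.rhs.weaken⟩

/-- Index contexts. -/
abbrev ICtx (Θ : ℕ → Type u) (k : ℕ) : Type u := List (Constraint Θ k)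

/-- The index context `a < I, Φ`, where `a` is a new variable (the variable `0`);
`a < I` is the constraint `a + 1 ≤ I`. -/
def ICtx.bind {k : ℕ} (Φ : ICtx Θ k) (I : Idx Θ k) : ICtx Θ (k + 1) :=
  ⟨.add (.var 0) .one, I.weaken⟩ :: Φ.map Constraint.weaken

/-- The semantic judgement `Φ ⊨ I ≤ J`. -/
def Entails (φ : Interp Θ) {k : ℕ} (Φ : ICtx Θ k) (I J : Idx Θ k) : Prop :=
  ∀ ρ : Fin k → ℕ, (∀ c ∈ Φ, c.Holds φ ρ) → Constraint.Holds φ ⟨I, J⟩ ρ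

/-! ## Types -/

/-- Modal types: `nat I J` is `Nat[I, J]`, and `bang I σ τ` is `[a < I] · (σ ⊸ τ)`, with `a`
the variable `0` of `σ` and `τ`. -/
inductive MType (Θ : ℕ → Type u) : ℕ → Type u
  | nat {k : ℕ} (I J : Idx Θ k) : MType Θ k
  | bang {k : ℕ} (I : Idx Θ k) (σ τ : MType Θ (k + 1)) : MType Θ k

/-- Simultaneous substitution of index terms in a modal type. -/
def MType.subst : {k : ℕ} → MType Θ k → {l : ℕ} → (Fin k → Idx Θ l) → MType Θ l
  | _, .nat I J, _, s => .nat (I.subst s) (J.subst s)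
  | _, .bang I σ τ, _, s => .bang (I.subst s) (σ.subst (Idx.liftSub s)) (τ.subst (Idx.liftSub s))

/-- Substitution of an index term for the variable `0`. -/
def MType.inst {k : ℕ} (σ : MType Θ (k + 1)) (I : Idx Θ k) : MType Θ k :=
  σ.subst (Fin.cases I (fun i => .var i))

/-- Linear types: `⟨σ, τ⟩` is `σ ⊸ τ`. -/
structure LType (Θ : ℕ → Type u) (k : ℕ) : Type u where
  dom : MType Θ k
  cod : MType Θ k

def LType.subst {k l : ℕ} (A : LType Θ k) (s : Fin k → Idx Θ l) : LType Θ l :=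
  ⟨A.dom.subst s, A.cod.subst s⟩

def LType.inst {k : ℕ} (A : LType Θ (k + 1)) (I : Idx Θ k) : LType Θ k :=
  ⟨A.dom.inst I, A.cod.inst I⟩

/-- The modal type `[a < I] · A`. -/
def MType.box {k : ℕ} (I : Idx Θ k) (A : LType Θ (k + 1)) : MType Θ k :=
  .bang I A.dom A.cod

/-- Subtyping of modal types. -/
inductive Sub (φ : Interp Θ) : {k : ℕ} → ICtx Θ k → MType Θ k → MType Θ k → Prop
  | nat {k : ℕ} {Φ : ICtx Θ k} {I J K H : Idx Θ k} :
      Entails φ Φ K I → Entails φ Φ J H → Sub φ Φ (.nat I J) (.nat K H)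
  | bang {k : ℕ} {Φ : ICtx Θ k} {I J : Idx Θ k} {σ τ σ' τ' : MType Θ (k + 1)} :
      Sub φ (Φ.bind J) σ' σ → Sub φ (Φ.bind J) τ τ' → Entails φ Φ J I →
      Sub φ Φ (.bang I σ τ) (.bang J σ' τ')

/-- Subtyping of linear types. -/
def LSub (φ : Interp Θ) {k : ℕ} (Φ : ICtx Θ k) (A B : LType Θ k) : Prop :=
  Sub φ Φ B.dom A.dom ∧ Sub φ Φ A.cod B.cod

/-- `MSum σ τ θ`: the sum `σ ⊎ τ` is defined and equal to `θ`. -/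
inductive MSum {k : ℕ} : MType Θ k → MType Θ k → MType Θ k → Prop
  | nat (I J : Idx Θ k) : MSum (.nat I J) (.nat I J) (.nat I J)
  -- `[a < I] · A{a/c}` plus `[b < J] · A{I + b/c}` is `[c < I + J] · A`
  | box (I J : Idx Θ k) (A : LType Θ (k + 1)) :
      MSum (.box I A)
        (.box J (A.subst (Fin.cases (.add I.weaken (.var 0)) (fun i => .var i.succ))))
        (.box (.add I J) A)

/-- `BSum I σ θ`: the bounded sum `∑_{a < I} σ` is defined and equal to `θ`; here `a` is the
variable `0` of `σ`. -/
inductive BSum {k : ℕ} (I : Idx Θ k) : MType Θ (k + 1) → MType Θ k → Prop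
  | nat (J K : Idx Θ k) : BSum I (.nat J.weaken K.weaken) (.nat J K)
  -- the sum of the `[b < J] · A{b + ∑_{d < a} J{d/a}/c}` is `[c < ∑_{a < I} J] · A`;
  -- in the scope `b, a, …` the variables `b` and `a` are `0` and `1`
  | box (J : Idx Θ (k + 1)) (A : LType Θ (k + 1)) :
      BSum I
        (.box J (A.subst (Fin.cases
          (.add (.var 0) (.sum (.var 1) (J.rename (liftRen (fun i => i.succ.succ)))))
          (fun i => .var i.succ.succ))))
        (.box (.sum I J) A)

/-! ## Contexts and typing -/

/-- Contexts assign modal types to some of the term variables. -/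
abbrev Ctx (Θ : ℕ → Type u) (k : ℕ) : Type u := ℕ → Option (MType Θ k)

def Ctx.empty {k : ℕ} : Ctx Θ k := fun _ => none

/-- The context `Γ, x : σ`, where `x` is the new term variable `0`. -/
def Ctx.cons {k : ℕ} (σ : MType Θ k) (Γ : Ctx Θ k) : Ctx Θ k
  | 0 => some σ
  | x + 1 => Γ x

/-- Sum of the types of a variable in two contexts. -/
inductive OptSum {k : ℕ} :
    Option (MType Θ k) → Option (MType Θ k) → Option (MType Θ k) → Prop
  | none : OptSum none none none
  | left (σ : MType Θ k) : OptSum (some σ) none (some σ)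
  | right (τ : MType Θ k) : OptSum none (some τ) (some τ)
  | both {σ τ θ : MType Θ k} : MSum σ τ θ → OptSum (some σ) (some τ) (some θ)

/-- `CtxSum Γ Δ Ξ`: the sum `Γ ⊎ Δ` is defined and equal to `Ξ`. -/
def CtxSum {k : ℕ} (Γ Δ Ξ : Ctx Θ k) : Prop := ∀ x, OptSum (Γ x) (Δ x) (Ξ x)

/-- `CtxBSum I Γ Δ`: the bounded sum `∑_{a < I} Γ` is defined and equal to `Δ`. -/
def CtxBSum {k : ℕ} (I : Idx Θ k) (Γ : Ctx Θ (k + 1)) (Δ : Ctx Θ k) : Prop :=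
  ∀ x, Option.Rel (BSum I) (Γ x) (Δ x)

/-- Subtyping of contexts with the same domain. -/
def CtxSub (φ : Interp Θ) {k : ℕ} (Φ : ICtx Θ k) (Δ Γ : Ctx Θ k) : Prop :=
  ∀ x, Option.Rel (Sub φ Φ) (Δ x) (Γ x)

/-- `Typing φ Φ Γ I t τ`: the term `t` has type `τ` and weight `I` in the context `Γ`, under the
constraints `Φ` on the `k` index variables in scope. -/
inductive Typing (φ : Interp Θ) :
    {k : ℕ} → ICtx Θ k → Ctx Θ k → Idx Θ k → Term → MType Θ k → Prop
  | var {k : ℕ} {Φ : ICtx Θ k} {Γ : Ctx Θ k} {x : ℕ} {σ : MType Θ k} :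
      Γ x = some σ → Typing φ Φ Γ .zero (.var x) σ
  | sub {k : ℕ} {Φ : ICtx Θ k} {Γ Δ : Ctx Θ k} {I J : Idx Θ k} {t : Term} {σ τ : MType Θ k} :
      Typing φ Φ Γ I t σ → CtxSub φ Φ Δ Γ → Sub φ Φ σ τ → Entails φ Φ I J →
      Typing φ Φ Δ J t τ
  | lam {k : ℕ} {Φ : ICtx Θ k} {Γ : Ctx Θ (k + 1)} {Δ : Ctx Θ k} {I : Idx Θ k}
      {K : Idx Θ (k + 1)} {t : Term} {σ τ : MType Θ (k + 1)} :
      Typing φ (Φ.bind I) (Γ.cons σ) K t τ → CtxBSum I Γ Δ →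
      Typing φ Φ Δ (.add I (.sum I K)) (.lam t) (.bang I σ τ)
  | app {k : ℕ} {Φ : ICtx Θ k} {Γ Δ Ξ : Ctx Θ k} {K H : Idx Θ k} {t u : Term}
      {σ τ : MType Θ (k + 1)} :
      Typing φ Φ Γ K t (.bang .one σ τ) → Typing φ Φ Δ H u (σ.inst .zero) → CtxSum Γ Δ Ξ →
      Typing φ Φ Ξ (.add K H) (.app t u) (τ.inst .zero)
  | ifz {k : ℕ} {Φ : ICtx Θ k} {Γ Δ Ξ : Ctx Θ k} {M N J K : Idx Θ k} {t u s : Term}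
      {τ : MType Θ k} :
      Typing φ Φ Γ M t (.nat J K) →
      Typing φ (⟨J, .zero⟩ :: Φ) Δ N u τ → Typing φ (⟨.one, K⟩ :: Φ) Δ N s τ →
      CtxSum Γ Δ Ξ → Typing φ Φ Ξ (.add M N) (.ifz t u s) τ
  | num {k : ℕ} {Φ : ICtx Θ k} {Γ : Ctx Θ k} (n : ℕ) :
      Typing φ Φ Γ .zero (.num n) (.nat (.numeral n) (.numeral n))
  | succ {k : ℕ} {Φ : ICtx Θ k} {Γ : Ctx Θ k} {M I J : Idx Θ k} {t : Term} :
      Typing φ Φ Γ M t (.nat I J) →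
      Typing φ Φ Γ M (.succ t) (.nat (.add I .one) (.add J .one))
  | pred {k : ℕ} {Φ : ICtx Θ k} {Γ : Ctx Θ k} {M I J : Idx Θ k} {t : Term} :
      Typing φ Φ Γ M t (.nat I J) →
      Typing φ Φ Γ M (.pred t) (.nat (.monus I .one) (.monus J .one))
  -- `H` is the number of nodes of the first `K` trees of the forest described by `I`, in which
  -- `b` is the variable `0` of `I`, `J` and `Γ`; in the scope `a, b, …` of `A` and `B`
  -- the variables `a` and `b` are `0` and `1`
  | fix {k : ℕ} {Φ : ICtx Θ k} {Γ : Ctx Θ (k + 1)} {Δ : Ctx Θ k} {K H : Idx Θ k}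
      {I J : Idx Θ (k + 1)} {t : Term} {A B : LType Θ (k + 2)} :
      H = .forest .zero K I →
      Typing φ (Φ.bind H) (Γ.cons (.box I A)) J t (.box .one B) →
      LSub φ ((Φ.bind H).bind I)
        ((B.inst .zero).subst (Fin.cases
          (.add (.add
            (.forest (.add (.var 1) .one) (.var 0) (I.rename (liftRen (fun i => i.succ.succ))))
            (.var 1)) .one)
          (fun i => .var i.succ.succ)))
        A →
      CtxBSum H Γ Δ →
      Typing φ Φ Δ (.add H (.sum H J)) (.fix t)
        (.box K ((B.inst .zero).subst (Fin.cases
          (.forest .zero (.var 0) (I.rename (liftRen Fin.succ)))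
          (fun i => .var i.succ))))

end Judgements

end DlPCF

/-!
The proof goes through a type system without index variables. A point of a simple type
(`PTy.Sem`) is a number or, for an arrow type, a finite *list* of pairs of points, one for each use
that is made of the function: `[a < I] · (σ ⊸ τ)` at one assignment of the index variables. In the
derivations of this system (`TTerm.Deriv`) an abstraction carries one derivation of its body for
each use, and a fixpoint carries a forest of derivations of its body, in which the children of a
node are the recursive calls. Lists are ordered, because the sums of modal types are; this does no
harm, since every closure of the machine has an environment of its own.

*Evaluation gives a derivation.* Derivations extend to environments, stacks and states of the
machine, with weights adding up. Going backwards along a run (`StateDeriv.of_steps`), a transition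
that duplicates an environment is undone by concatenating lists and forests (`TEnv.Deriv.add`), a
call of an abstraction adds a use of weight `1` (`StateDeriv.expand_lam`), and a call of a fixpoint
adds a root above the forest of its recursive calls (`StateDeriv.expand_fix`). So the initial state
is derivable, with the number of calls as its weight.

*Derivations can be made uniform.* A family of derivations of one simply typed term, indexed by the
finitely many assignments that satisfy an index context, is the meaning of a single linear
dependent derivation (`TTerm.uniform`). A bound variable `a < I` merely enlarges the finite set of
assignments. All index terms that are needed are tables on a finite set of assignments, hence
computable, and universality provides them (`Interp.Universal.exists_idx`). Types with the same
meaning are subtypes of each other (`Represents.sub`), so that for a sum of types it suffices to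
find some summands of the syntactic form which the rules require and with the right meanings
(`Interp.Universal.exists_mSum`, `Interp.Universal.exists_bSum`). For a fixpoint, the nodes of the
forests are listed in pre-order, and forest cardinalities compute the positions of the roots and of
the children of a node (`IsForest.forestCard`). Families may be empty, as in a branch of a
conditional that is never taken; this is where the simple typing of the term is used.
-/

namespace DlPCF

universe u

variable {Θ : ℕ → Type u} {φ : Interp Θ}

/-! ### Semantics of index terms -/

theorem ForestCard.mono {κ κ' : ℕ → ℕ → Prop} (h : ∀ i c, κ i c → κ' i c) {i j n : ℕ}
    (hf : ForestCard κ i j n) : ForestCard κ' i j n := by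
  induction hf with
  | zero i => exact .zero i
  | succ _ hc _ ih ih' => exact .succ ih (h _ _ hc) ih'

theorem ForestCard.unique {κ : ℕ → ℕ → Prop} (hκ : ∀ i c c', κ i c → κ i c' → c = c')
    {i j n n' : ℕ} (h : ForestCard κ i j n) (h' : ForestCard κ i j n') : n = n' := by
  induction h generalizing n' with
  | zero i => cases h'; rfl
  | succ _ hc _ ih ih' =>
    cases h' with
    | succ h₁ hc' h₂ =>
      obtain rfl := ih h₁
      obtain rfl := hκ _ _ _ hc hc'
      rw [ih' h₂]

/-- A forest of `j + j'` trees is a forest of `j` trees followed by one of `j'` trees. -/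
theorem ForestCard.append {κ : ℕ → ℕ → Prop} {i j n j' n' : ℕ} (h : ForestCard κ i j n)
    (h' : ForestCard κ (i + n) j' n') : ForestCard κ i (j + j') (n + n') := by
  generalize hi : i + n = i' at h'
  induction h' with
  | zero => exact h
  | @succ i' j' m c p _ hc hp ih ih' =>
    subst hi
    have hm := ih rfl
    rw [show n + (m + 1 + p) = n + m + 1 + p by omega]
    refine .succ hm (by rwa [← add_assoc]) ?_
    rwa [show i + 1 + (n + m) = i + n + 1 + m by omega]

namespace Idx

theorem HasValue.unique {k : ℕ} {I : Idx Θ k} {ρ : Fin k → ℕ} {m n : ℕ}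
    (hm : I.HasValue φ ρ m) (hn : I.HasValue φ ρ n) : m = n := by
  induction I generalizing m n with
  | var a => simp only [HasValue] at hm hn; omega
  | zero => simp only [HasValue] at hm hn; omega
  | one => simp only [HasValue] at hm hn; omega
  | add I J ihI ihJ =>
    obtain ⟨x, y, hx, hy, rfl⟩ := hm
    obtain ⟨x', y', hx', hy', rfl⟩ := hn
    rw [ihI hx hx', ihJ hy hy']
  | monus I J ihI ihJ =>
    obtain ⟨x, y, hx, hy, rfl⟩ := hm
    obtain ⟨x', y', hx', hy', rfl⟩ := hn
    rw [ihI hx hx', ihJ hy hy']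
  | app f args ih =>
    obtain ⟨v, hv, hm⟩ := hm
    obtain ⟨v', hv', hn⟩ := hn
    obtain rfl : v = v' := funext fun i => ih i (hv i) (hv' i)
    exact Part.mem_unique hm hn
  | sum I J ihI ihJ =>
    obtain ⟨x, v, hx, hv, rfl⟩ := hm
    obtain ⟨x', v', hx', hv', rfl⟩ := hn
    obtain rfl := ihI hx hx'
    exact Finset.sum_congr rfl fun i hi =>
      ihJ (hv i (Finset.mem_range.1 hi)) (hv' i (Finset.mem_range.1 hi))
  | forest I J K ihI ihJ ihK =>
    obtain ⟨x, y, hx, hy, hf⟩ := hm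
    obtain ⟨x', y', hx', hy', hf'⟩ := hn
    obtain rfl := ihI hx hx'
    obtain rfl := ihJ hy hy'
    exact hf.unique (fun i _ _ h h' => ihK (ρ := Fin.cons i ρ) h h') hf'

theorem HasValue.iff_eq {k : ℕ} {I : Idx Θ k} {ρ : Fin k → ℕ} {n : ℕ}
    (hn : I.HasValue φ ρ n) (m : ℕ) : I.HasValue φ ρ m ↔ m = n :=
  ⟨fun h => h.unique hn, fun h => h ▸ hn⟩

theorem cons_comp_liftRen {k l : ℕ} (r : Fin k → Fin l) (ρ : Fin l → ℕ) (i : ℕ) :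
    (Fin.cons i ρ : Fin (l + 1) → ℕ) ∘ liftRen r = Fin.cons i (ρ ∘ r) := by
  funext j
  induction j using Fin.cases <;> simp [liftRen]

theorem hasValue_rename {k l : ℕ} (I : Idx Θ k) (r : Fin k → Fin l) (ρ : Fin l → ℕ) (m : ℕ) :
    (I.rename r).HasValue φ ρ m ↔ I.HasValue φ (ρ ∘ r) m := by
  induction I generalizing l m with
  | sum I J ihI ihJ => simp only [rename, HasValue, ihI, ihJ, cons_comp_liftRen]
  | forest I J K ihI ihJ ihK => simp only [rename, HasValue, ihI, ihJ, ihK, cons_comp_liftRen]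
  | _ => simp_all [rename, HasValue]

theorem hasValue_weaken {k : ℕ} (I : Idx Θ k) (ρ : Fin k → ℕ) (i m : ℕ) :
    I.weaken.HasValue φ (Fin.cons i ρ : Fin (k + 1) → ℕ) m ↔ I.HasValue φ ρ m := by
  rw [weaken, hasValue_rename]
  rfl

/-- The substitution `s` is defined at `ρ`, with values `ρ'`. -/
def SubstValue (φ : Interp Θ) {k l : ℕ} (s : Fin k → Idx Θ l) (ρ : Fin l → ℕ)
    (ρ' : Fin k → ℕ) : Prop :=
  ∀ i, (s i).HasValue φ ρ (ρ' i)

theorem SubstValue.lift {k l : ℕ} {s : Fin k → Idx Θ l} {ρ : Fin l → ℕ} {ρ' : Fin k → ℕ}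
    (h : SubstValue φ s ρ ρ') (i : ℕ) :
    SubstValue φ (liftSub s) (Fin.cons i ρ : Fin (l + 1) → ℕ) (Fin.cons i ρ') := by
  intro j
  induction j using Fin.cases with
  | zero => simp [liftSub, HasValue]
  | succ j => simpa [liftSub, hasValue_weaken] using h j

theorem hasValue_subst {k l : ℕ} (I : Idx Θ k) {s : Fin k → Idx Θ l} {ρ : Fin l → ℕ}
    {ρ' : Fin k → ℕ} (h : SubstValue φ s ρ ρ') (m : ℕ) :
    (I.subst s).HasValue φ ρ m ↔ I.HasValue φ ρ' m := by
  induction I generalizing l m with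
  | var a => simpa only [subst, HasValue] using (h a).iff_eq m
  | zero => rfl
  | one => rfl
  | add I J ihI ihJ => simp only [subst, HasValue, ihI h, ihJ h]
  | monus I J ihI ihJ => simp only [subst, HasValue, ihI h, ihJ h]
  | app f args ih => simp only [subst, HasValue, ih _ h]
  | sum I J ihI ihJ => simp only [subst, HasValue, ihI h, ihJ (h.lift _)]
  | forest I J K ihI ihJ ihK => simp only [subst, HasValue, ihI h, ihJ h, ihK (h.lift _)]

theorem hasValue_numeral {k : ℕ} (n : ℕ) (ρ : Fin k → ℕ) :
    (numeral n : Idx Θ k).HasValue φ ρ n := by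
  induction n with
  | zero => rfl
  | succ n ih =>
    cases n with
    | zero => rfl
    | succ n => exact ⟨_, _, ih, rfl, rfl⟩

theorem hasValue_sum {k : ℕ} {I : Idx Θ k} {J : Idx Θ (k + 1)} {ρ : Fin k → ℕ} {x : ℕ}
    {v : ℕ → ℕ} (hI : I.HasValue φ ρ x)
    (hJ : ∀ i < x, J.HasValue φ (Fin.cons i ρ : Fin (k + 1) → ℕ) (v i)) :
    (Idx.sum I J).HasValue φ ρ (∑ i ∈ Finset.range x, v i) :=
  ⟨x, v, hI, hJ, rfl⟩

end Idx

/-! ### Index terms from finite tables -/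

/-- A function that is constant outside of a finite set is computable. -/
theorem exists_computable_eqOn {α : Type*} [Primcodable α] [DecidableEq α] {S : Set α}
    (hS : S.Finite) (f : α → ℕ) : ∃ g : α → ℕ, Computable g ∧ ∀ x ∈ S, g x = f x := by
  induction S, hS using Set.Finite.induction_on with
  | empty => exact ⟨fun _ => 0, Computable.const 0, by simp⟩
  | @insert a S _ _ ih =>
    obtain ⟨g, hg, hgf⟩ := ih
    refine ⟨fun x => bif decide (x = a) then f a else g x,
      Computable.cond ?_ (Computable.const _) hg, ?_⟩
    · exact (PrimrecRel.comp Primrec.eq Primrec.id (Primrec.const a)).decide.to_comp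
    · rintro x hx
      by_cases hxa : x = a
      · simp [hxa]
      · simpa [hxa] using hgf x (hx.resolve_left hxa)

/-- On a finite set of assignments, every function is the meaning of an index term. -/
theorem Interp.Universal.exists_idx (hU : φ.Universal) {k : ℕ} {S : Set (Fin k → ℕ)}
    (hS : S.Finite) (f : (Fin k → ℕ) → ℕ) : ∃ I : Idx Θ k, ∀ ρ ∈ S, I.HasValue φ ρ (f ρ) := by
  obtain ⟨g, hg, hgf⟩ := exists_computable_eqOn hS f
  obtain ⟨I, hI⟩ := hU k (fun x => Part.some (g x)) hg
  exact ⟨I, fun ρ hρ => (hI ρ _).2 (by simp [hgf ρ hρ])⟩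

/-! ### Models of index contexts -/

/-- The set of the assignments that satisfy all constraints of an index context. -/
def ICtx.models (φ : Interp Θ) {k : ℕ} (Φ : ICtx Θ k) : Set (Fin k → ℕ) :=
  {ρ | ∀ c ∈ Φ, c.Holds φ ρ}

/-- The assignments `a, ρ` with `ρ` in `S` and `a < N ρ`. -/
def extend {k : ℕ} (S : Set (Fin k → ℕ)) (N : (Fin k → ℕ) → ℕ) : Set (Fin (k + 1) → ℕ) :=
  {ρ | Fin.tail ρ ∈ S ∧ ρ 0 < N (Fin.tail ρ)}

theorem cons_mem_extend {k : ℕ} {S : Set (Fin k → ℕ)} {N : (Fin k → ℕ) → ℕ} {a : ℕ}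
    {ρ : Fin k → ℕ} :
    (Fin.cons a ρ : Fin (k + 1) → ℕ) ∈ extend S N ↔ ρ ∈ S ∧ a < N ρ := by
  simp [extend]

theorem finite_extend {k : ℕ} {S : Set (Fin k → ℕ)} (hS : S.Finite) (N : (Fin k → ℕ) → ℕ) :
    (extend S N).Finite := by
  refine (hS.biUnion fun ρ _ => (Set.finite_Iio (N ρ)).image
    fun a => (Fin.cons a ρ : Fin (k + 1) → ℕ)).subset fun ρ hρ => ?_
  simp only [Set.mem_iUnion, Set.mem_image]
  exact ⟨Fin.tail ρ, hρ.1, ρ 0, hρ.2, Fin.cons_self_tail ρ⟩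

theorem Constraint.holds_weaken {k : ℕ} (c : Constraint Θ k) (ρ : Fin k → ℕ) (a : ℕ) :
    c.weaken.Holds φ (Fin.cons a ρ : Fin (k + 1) → ℕ) ↔ c.Holds φ ρ := by
  simp only [Holds, weaken, Idx.hasValue_weaken]

theorem ICtx.models_bind {k : ℕ} {Φ : ICtx Θ k} {I : Idx Θ k} {N : (Fin k → ℕ) → ℕ}
    (hI : ∀ ρ ∈ Φ.models φ, I.HasValue φ ρ (N ρ)) :
    (Φ.bind I).models φ = extend (Φ.models φ) N := by
  ext ρ
  obtain ⟨a, ρ, rfl⟩ : ∃ a ρ', ρ = Fin.cons a ρ' := ⟨_, _, (Fin.cons_self_tail ρ).symm⟩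
  rw [cons_mem_extend]
  simp only [models, bind, List.mem_cons, List.mem_map, forall_eq_or_imp, Set.mem_ofPred_eq,
    forall_exists_index, and_imp, forall_apply_eq_imp_iff₂, Constraint.holds_weaken]
  rw [and_comm]
  refine and_congr_right fun hρ => ?_
  have hv := (hI ρ hρ).iff_eq
  simp only [Constraint.Holds, Idx.hasValue_weaken, hv, Idx.HasValue, Fin.cons_zero]
  constructor
  · rintro ⟨m, n, ⟨x, y, rfl, rfl, rfl⟩, rfl, h⟩
    exact h
  · exact fun h => ⟨_, _, ⟨_, _, rfl, rfl, rfl⟩, rfl, h⟩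

/-! ### Semantic types -/

/-- The points of a simple type: numbers for `nat`, and for an arrow type the finite *lists* of
pairs of points. A list is the ordered, non-idempotent intersection of the uses
`σ ⊸ τ` that are made of a function; it is what `[a < I] · (σ ⊸ τ)` means at an
assignment of its index variables. -/
def PTy.Sem : PTy → Type
  | .nat => ℕ
  | .arr α β => List (α.Sem × β.Sem)

instance PTy.Sem.instInhabited : (α : PTy) → Inhabited α.Sem
  | .nat => ⟨(0 : ℕ)⟩
  | .arr α β => ⟨([] : List (α.Sem × β.Sem))⟩

/-- The number of uses in a point of an arrow type. -/
def PTy.Sem.size {α β : PTy} (l : (PTy.arr α β).Sem) : ℕ := List.length l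

/-- The `i`-th use in a point of an arrow type, with a default value beyond the end. -/
def PTy.Sem.entry {α β : PTy} (l : (PTy.arr α β).Sem) (i : ℕ) : α.Sem × β.Sem :=
  List.getD l i default

/-- The point of an arrow type that consists of a single use. -/
def PTy.Sem.single {α β : PTy} (p : α.Sem × β.Sem) : (PTy.arr α β).Sem := [p]

@[simp] theorem PTy.Sem.entry_single {α β : PTy} (p : α.Sem × β.Sem) :
    (single p).entry 0 = p := rfl

/-- `IsSum α l s`: the point `s` is the sum of the points in the list `l`. The sum of points of an
arrow type is their concatenation; points of `nat` can be added only if they are all equal. -/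
def IsSum : (α : PTy) → List α.Sem → α.Sem → Prop
  | .nat, l, n => ∀ x ∈ l, x = n
  | .arr α β, l, s => s = List.flatten (α := α.Sem × β.Sem) l

/-- The length of the concatenation of the lists `F 0, F 1, …`, and the positions in it of their
entries. -/
theorem flatten_map_range {X : Type*} (d : X) (F : ℕ → List X) (N : ℕ) :
    ((List.range N).map F).flatten.length = ∑ i ∈ Finset.range N, (F i).length ∧
      ∀ a < N, ∀ b < (F a).length,
        b + ∑ i ∈ Finset.range a, (F i).length < ((List.range N).map F).flatten.length ∧
        ((List.range N).map F).flatten.getD (b + ∑ i ∈ Finset.range a, (F i).length) d =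
          (F a).getD b d := by
  induction N with
  | zero => simp
  | succ N ih =>
    have hlen := ih.1
    have hfl : ((List.range (N + 1)).map F).flatten = ((List.range N).map F).flatten ++ F N := by
      simp [List.range_succ]
    rw [hfl, List.length_append, Finset.sum_range_succ, hlen]
    refine ⟨rfl, fun a ha b hb => ?_⟩
    rcases Nat.lt_succ_iff_lt_or_eq.1 ha with ha | rfl
    · obtain ⟨h₁, h₂⟩ := ih.2 a ha b hb
      exact ⟨by omega, by rw [List.getD_append _ _ _ _ h₁, h₂]⟩
    · refine ⟨by omega, ?_⟩
      rw [List.getD_append_right _ _ _ _ (by omega), hlen, Nat.add_sub_cancel]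

/-! ### Families of points represented by modal types -/

/-- `Represents φ S α σ T`: at every assignment `ρ` in `S`, the modal type `σ` has the shape of
the simple type `α` and means the point `T ρ`. The shape is required even if `S` is empty. -/
def Represents (φ : Interp Θ) : {k : ℕ} → Set (Fin k → ℕ) → (α : PTy) → MType Θ k →
    ((Fin k → ℕ) → α.Sem) → Prop
  | _, S, .nat, .nat I J, T => ∀ ρ ∈ S, I.HasValue φ ρ (T ρ) ∧ J.HasValue φ ρ (T ρ)
  | _, S, .arr α β, .bang I σ τ, T =>
      (∀ ρ ∈ S, I.HasValue φ ρ (T ρ).size) ∧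
      Represents φ (extend S fun ρ => (T ρ).size) α σ
        (fun ρ => ((T (Fin.tail ρ)).entry (ρ 0)).1) ∧
      Represents φ (extend S fun ρ => (T ρ).size) β τ
        (fun ρ => ((T (Fin.tail ρ)).entry (ρ 0)).2)
  | _, _, .nat, .bang _ _ _, _ => False
  | _, _, .arr _ _, .nat _ _, _ => False

/-- Substitution of index terms in a modal type is reindexing of the family of its meanings. -/
theorem Represents.subst {α : PTy} {k l : ℕ} {S : Set (Fin k → ℕ)} {S' : Set (Fin l → ℕ)}
    {σ : MType Θ k} {T : (Fin k → ℕ) → α.Sem} {T' : (Fin l → ℕ) → α.Sem}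
    {s : Fin k → Idx Θ l} (h : Represents φ S α σ T) (f : (Fin l → ℕ) → Fin k → ℕ)
    (hf : ∀ ρ ∈ S', f ρ ∈ S ∧ Idx.SubstValue φ s ρ (f ρ) ∧ T (f ρ) = T' ρ) :
    Represents φ S' α (σ.subst s) T' := by
  induction α generalizing k l with
  | nat =>
    cases σ with
    | bang => exact h.elim
    | nat I J =>
      intro ρ hρ
      obtain ⟨hS, hs, hT⟩ := hf ρ hρ
      exact hT ▸ ⟨(Idx.hasValue_subst I hs _).2 (h _ hS).1,
        (Idx.hasValue_subst J hs _).2 (h _ hS).2⟩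
  | arr α β ihα ihβ =>
    cases σ with
    | nat => exact h.elim
    | bang I σ τ =>
      obtain ⟨hI, hσ, hτ⟩ := h
      refine ⟨fun ρ hρ => ?_, ihα hσ (fun ρ => Fin.cons (ρ 0) (f (Fin.tail ρ))) ?_,
        ihβ hτ (fun ρ => Fin.cons (ρ 0) (f (Fin.tail ρ))) ?_⟩
      · obtain ⟨hS, hs, hT⟩ := hf ρ hρ
        rw [Idx.hasValue_subst I hs, ← hT]
        exact hI _ hS
      all_goals
        rintro ρ ⟨hρ, ha⟩
        obtain ⟨hS, hs, hT⟩ := hf _ hρ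
        refine ⟨cons_mem_extend.2 ⟨hS, by rwa [hT]⟩, ?_, by simp [hT]⟩
        have := hs.lift (ρ 0)
        rwa [Fin.cons_self_tail] at this

theorem Represents.congr {α : PTy} {k : ℕ} {S S' : Set (Fin k → ℕ)}
    {σ : MType Θ k} {T T' : (Fin k → ℕ) → α.Sem} (h : Represents φ S α σ T)
    (hf : ∀ ρ ∈ S', ρ ∈ S ∧ T ρ = T' ρ) : Represents φ S' α σ T' := by
  induction α generalizing k with
  | nat =>
    cases σ with
    | bang => exact h.elim
    | nat I J =>
      intro ρ hρ
      rw [← (hf ρ hρ).2]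
      exact h _ (hf ρ hρ).1
  | arr α β ihα ihβ =>
    cases σ with
    | nat => exact h.elim
    | bang I σ τ =>
      obtain ⟨hI, hσ, hτ⟩ := h
      refine ⟨fun ρ hρ => ?_, ihα hσ ?_, ihβ hτ ?_⟩
      · rw [← (hf ρ hρ).2]
        exact hI _ (hf ρ hρ).1
      all_goals
        rintro ρ ⟨hρ, ha⟩
        obtain ⟨hS, hT⟩ := hf _ hρ
        exact ⟨⟨hS, by simpa only [hT] using ha⟩, by rw [hT]⟩

theorem Represents.inst_zero {α : PTy} {k : ℕ} {S : Set (Fin (k + 1) → ℕ)}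
    {S' : Set (Fin k → ℕ)} {σ : MType Θ (k + 1)} {T : (Fin (k + 1) → ℕ) → α.Sem}
    {T' : (Fin k → ℕ) → α.Sem} (h : Represents φ S α σ T)
    (hf : ∀ ρ ∈ S', Fin.cons 0 ρ ∈ S ∧ T (Fin.cons 0 ρ) = T' ρ) :
    Represents φ S' α (σ.inst .zero) T' := by
  refine h.subst (fun ρ => Fin.cons 0 ρ) fun ρ hρ => ⟨(hf ρ hρ).1, fun i => ?_, (hf ρ hρ).2⟩
  induction i using Fin.cases <;> simp [Idx.HasValue]

/-- On a finite set of assignments, every family of points is represented by a modal type. -/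
theorem Interp.Universal.exists_represents (hU : φ.Universal) {α : PTy} {k : ℕ}
    {S : Set (Fin k → ℕ)} (hS : S.Finite) (T : (Fin k → ℕ) → α.Sem) :
    ∃ σ : MType Θ k, Represents φ S α σ T := by
  induction α generalizing k with
  | nat =>
    obtain ⟨I, hI⟩ := hU.exists_idx hS T
    exact ⟨.nat I I, fun ρ hρ => ⟨hI ρ hρ, hI ρ hρ⟩⟩
  | arr α β ihα ihβ =>
    obtain ⟨I, hI⟩ := hU.exists_idx hS fun ρ => (T ρ).size
    have hS' := finite_extend hS fun ρ => (T ρ).size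
    obtain ⟨σ, hσ⟩ := ihα hS' fun ρ => ((T (Fin.tail ρ)).entry (ρ 0)).1
    obtain ⟨τ, hτ⟩ := ihβ hS' fun ρ => ((T (Fin.tail ρ)).entry (ρ 0)).2
    exact ⟨.bang I σ τ, hI, hσ, hτ⟩

theorem Entails.of_hasValue {k : ℕ} {Φ : ICtx Θ k} {I J : Idx Θ k} {N : (Fin k → ℕ) → ℕ}
    (hI : ∀ ρ ∈ Φ.models φ, I.HasValue φ ρ (N ρ))
    (hJ : ∀ ρ ∈ Φ.models φ, J.HasValue φ ρ (N ρ)) : Entails φ Φ I J :=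
  fun ρ hρ => ⟨_, _, hI ρ hρ, hJ ρ hρ, le_rfl⟩

/-- Modal types with the same meaning are subtypes of each other. -/
theorem Represents.sub {α : PTy} {k : ℕ} {Φ : ICtx Θ k} {σ τ : MType Θ k}
    {T : (Fin k → ℕ) → α.Sem} (hσ : Represents φ (Φ.models φ) α σ T)
    (hτ : Represents φ (Φ.models φ) α τ T) : Sub φ Φ σ τ := by
  induction α generalizing k with
  | nat =>
    cases σ with
    | bang => exact hσ.elim
    | nat I J =>
      cases τ with
      | bang => exact hτ.elim
      | nat K H =>
        exact .nat (.of_hasValue (fun ρ hρ => (hτ ρ hρ).1) fun ρ hρ => (hσ ρ hρ).1)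
          (.of_hasValue (fun ρ hρ => (hσ ρ hρ).2) fun ρ hρ => (hτ ρ hρ).2)
  | arr α β ihα ihβ =>
    cases σ with
    | nat => exact hσ.elim
    | bang I σ₁ σ₂ =>
      cases τ with
      | nat => exact hτ.elim
      | bang J τ₁ τ₂ =>
        obtain ⟨hI, hσ₁, hσ₂⟩ := hσ
        obtain ⟨hJ, hτ₁, hτ₂⟩ := hτ
        rw [← ICtx.models_bind hJ] at *
        exact .bang (ihα hτ₁ hσ₁) (ihβ hσ₂ hτ₂) (.of_hasValue hJ hI)

/-! ### Sums of represented families -/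

/-- Families of points that add up are represented by modal types with a syntactic sum: a type for
the sum is chosen first, and the rule then dictates the summands. -/
theorem Interp.Universal.exists_mSum (hU : φ.Universal) {α : PTy} {k : ℕ}
    {S : Set (Fin k → ℕ)} (hS : S.Finite) {F G H : (Fin k → ℕ) → α.Sem}
    (h : ∀ ρ ∈ S, IsSum α [F ρ, G ρ] (H ρ)) :
    ∃ σ τ θ : MType Θ k, MSum σ τ θ ∧ Represents φ S α σ F ∧ Represents φ S α τ G ∧
      Represents φ S α θ H := by
  cases α with
  | nat =>
    obtain ⟨σ, hσ⟩ := hU.exists_represents hS H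
    have hF : Represents φ S .nat σ F :=
      hσ.congr fun ρ hρ => ⟨hρ, (h ρ hρ (F ρ) (by simp)).symm⟩
    have hG : Represents φ S .nat σ G :=
      hσ.congr fun ρ hρ => ⟨hρ, (h ρ hρ (G ρ) (by simp)).symm⟩
    cases σ with
    | bang => exact hσ.elim
    | nat I J => exact ⟨_, _, _, .nat I J, hF, hG, hσ⟩
  | arr α β =>
    replace h : ∀ ρ ∈ S, H ρ = List.append (F ρ) (G ρ) := fun ρ hρ =>
      (h ρ hρ).trans (congrArg (List.append (F ρ)) (List.append_nil _))
    have hlen : ∀ ρ ∈ S, (H ρ).size = (F ρ).size + (G ρ).size := fun ρ hρ => by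
      rw [h ρ hρ]
      exact List.length_append
    obtain ⟨I, hI⟩ := hU.exists_idx hS fun ρ => (F ρ).size
    obtain ⟨J, hJ⟩ := hU.exists_idx hS fun ρ => (G ρ).size
    have hS' := finite_extend hS fun ρ => (H ρ).size
    obtain ⟨σ, hσ⟩ := hU.exists_represents hS' fun ρ => ((H (Fin.tail ρ)).entry (ρ 0)).1
    obtain ⟨τ, hτ⟩ := hU.exists_represents hS' fun ρ => ((H (Fin.tail ρ)).entry (ρ 0)).2
    have hleft : ∀ ρ ∈ extend S fun ρ => (F ρ).size, ρ ∈ (extend S fun ρ => (H ρ).size) ∧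
        (H (Fin.tail ρ)).entry (ρ 0) = (F (Fin.tail ρ)).entry (ρ 0) := by
      rintro ρ ⟨hρ, ha⟩
      refine ⟨⟨hρ, ha.trans_le ((Nat.le_add_right _ _).trans_eq (hlen _ hρ).symm)⟩, ?_⟩
      rw [h _ hρ]
      exact List.getD_append _ _ _ _ ha
    have hright : ∀ ρ ∈ extend S fun ρ => (G ρ).size,
        (Fin.cons ((F (Fin.tail ρ)).size + ρ 0) (Fin.tail ρ) : Fin (k + 1) → ℕ) ∈
          (extend S fun ρ => (H ρ).size) ∧
        Idx.SubstValue φ (Fin.cases (.add I.weaken (.var 0)) (fun i => .var i.succ)) ρ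
          (Fin.cons ((F (Fin.tail ρ)).size + ρ 0) (Fin.tail ρ) : Fin (k + 1) → ℕ) ∧
        (H (Fin.tail ρ)).entry ((F (Fin.tail ρ)).size + ρ 0) =
          (G (Fin.tail ρ)).entry (ρ 0) := by
      rintro ρ ⟨hρ, ha⟩
      refine ⟨cons_mem_extend.2 ⟨hρ, (Nat.add_lt_add_left ha _).trans_eq (hlen _ hρ).symm⟩,
        fun i => ?_, ?_⟩
      · induction i using Fin.cases with
        | zero =>
          refine ⟨_, _, ?_, rfl, rfl⟩
          rw [← Fin.cons_self_tail ρ, Idx.hasValue_weaken]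
          exact hI _ hρ
        | succ i => exact rfl
      · rw [h _ hρ]
        refine (List.getD_append_right _ _ _ _ (Nat.le_add_right _ _)).trans ?_
        exact congrArg (fun i => List.getD _ i _) (Nat.add_sub_cancel_left _ _)
    refine ⟨_, _, _, .box I J ⟨σ, τ⟩, ⟨hI, ?_, ?_⟩, ⟨hJ, ?_, ?_⟩, ⟨fun ρ hρ => ?_, hσ, hτ⟩⟩
    · exact hσ.congr fun ρ hρ => ⟨(hleft ρ hρ).1, congrArg Prod.fst (hleft ρ hρ).2⟩
    · exact hτ.congr fun ρ hρ => ⟨(hleft ρ hρ).1, congrArg Prod.snd (hleft ρ hρ).2⟩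
    · exact hσ.subst _ fun ρ hρ =>
        ⟨(hright ρ hρ).1, (hright ρ hρ).2.1, congrArg Prod.fst (hright ρ hρ).2.2⟩
    · exact hτ.subst _ fun ρ hρ =>
        ⟨(hright ρ hρ).1, (hright ρ hρ).2.1, congrArg Prod.snd (hright ρ hρ).2.2⟩
    · exact ⟨_, _, hI ρ hρ, hJ ρ hρ, hlen ρ hρ⟩

/-- The analogue of `exists_mSum` for bounded sums. -/
theorem Interp.Universal.exists_bSum (hU : φ.Universal) {α : PTy} {k : ℕ}
    {S : Set (Fin k → ℕ)} (hS : S.Finite) {I : Idx Θ k} {N : (Fin k → ℕ) → ℕ}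
    (hI : ∀ ρ ∈ S, I.HasValue φ ρ (N ρ)) {F : (Fin (k + 1) → ℕ) → α.Sem}
    {H : (Fin k → ℕ) → α.Sem}
    (h : ∀ ρ ∈ S, IsSum α ((List.range (N ρ)).map fun a => F (Fin.cons a ρ)) (H ρ)) :
    ∃ (σ : MType Θ (k + 1)) (θ : MType Θ k), BSum I σ θ ∧ Represents φ (extend S N) α σ F ∧
      Represents φ S α θ H := by
  cases α with
  | nat =>
    -- points of `nat` are added by not letting the type depend on the bound variable
    obtain ⟨J, hJ⟩ := hU.exists_idx hS H
    refine ⟨_, _, .nat J J, fun ρ hρ => ?_, fun ρ hρ => ⟨hJ ρ hρ, hJ ρ hρ⟩⟩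
    have hF : F ρ = H (Fin.tail ρ) := h _ hρ.1 _
      (List.mem_map.2 ⟨ρ 0, List.mem_range.2 hρ.2, by rw [Fin.cons_self_tail]⟩)
    have hJ' : J.weaken.HasValue φ ρ (F ρ) := by
      rw [hF]
      exact (Idx.hasValue_rename _ _ _ _).2 (hJ _ hρ.1)
    exact ⟨hJ', hJ'⟩
  | arr α β =>
    have hsize : ∀ ρ ∈ S, (H ρ).size = ∑ a ∈ Finset.range (N ρ), (F (Fin.cons a ρ)).size :=
      fun ρ hρ => by
        rw [h ρ hρ]
        exact (flatten_map_range default (fun a => F (Fin.cons a ρ)) (N ρ)).1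
    have hentry : ∀ ρ ∈ S, ∀ a < N ρ, ∀ b < (F (Fin.cons a ρ)).size,
        b + ∑ d ∈ Finset.range a, (F (Fin.cons d ρ)).size < (H ρ).size ∧
        (H ρ).entry (b + ∑ d ∈ Finset.range a, (F (Fin.cons d ρ)).size) =
          (F (Fin.cons a ρ)).entry b := fun ρ hρ => by
      rw [h ρ hρ]
      exact (flatten_map_range default (fun a => F (Fin.cons a ρ)) (N ρ)).2
    obtain ⟨J, hJ⟩ := hU.exists_idx (finite_extend hS N) fun ρ => (F ρ).size
    have hS' := finite_extend hS fun ρ => (H ρ).size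
    obtain ⟨σ, hσ⟩ := hU.exists_represents hS' fun ρ => ((H (Fin.tail ρ)).entry (ρ 0)).1
    obtain ⟨τ, hτ⟩ := hU.exists_represents hS' fun ρ => ((H (Fin.tail ρ)).entry (ρ 0)).2
    -- the reindexing `b, a, ρ ↦ b + ∑_{d < a} |F d|, ρ` that the rule for bounded sums performs
    let f : (Fin (k + 2) → ℕ) → Fin (k + 1) → ℕ := fun ρ =>
      Fin.cons (ρ 0 + ∑ d ∈ Finset.range (ρ 1), (F (Fin.cons d (Fin.tail (Fin.tail ρ)))).size)
        (Fin.tail (Fin.tail ρ))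
    have hf : ∀ ρ ∈ extend (extend S N) fun ρ => (F ρ).size,
        f ρ ∈ (extend S fun ρ => (H ρ).size) ∧
        Idx.SubstValue φ (Fin.cases
          (.add (.var 0) (.sum (.var 1) (J.rename (liftRen (fun i => i.succ.succ)))))
          (fun i => .var i.succ.succ)) ρ (f ρ) ∧
        (H (Fin.tail (f ρ))).entry (f ρ 0) = (F (Fin.tail ρ)).entry (ρ 0) := by
      rintro ρ ⟨⟨hρ, ha⟩, hb⟩
      obtain ⟨b, ρ, rfl⟩ : ∃ b ρ', ρ = Fin.cons b ρ' := ⟨_, _, (Fin.cons_self_tail ρ).symm⟩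
      obtain ⟨a, ρ, rfl⟩ : ∃ b ρ', ρ = Fin.cons b ρ' := ⟨_, _, (Fin.cons_self_tail ρ).symm⟩
      simp only [Fin.tail_cons, Fin.cons_zero] at hρ ha hb
      have hρ' := hentry ρ hρ a ha b hb
      refine ⟨cons_mem_extend.2 ⟨hρ, hρ'.1⟩, fun i => ?_, hρ'.2⟩
      induction i using Fin.cases with
      | zero =>
        refine ⟨_, _, rfl, ?_, rfl⟩
        refine Idx.hasValue_sum rfl fun d hd => ?_
        rw [Idx.hasValue_rename, Idx.cons_comp_liftRen]
        exact hJ _ (cons_mem_extend.2 ⟨hρ, lt_trans hd ha⟩)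
      | succ i => exact rfl
    refine ⟨_, _, .box J ⟨σ, τ⟩, ⟨hJ, ?_, ?_⟩, ⟨fun ρ hρ => ?_, hσ, hτ⟩⟩
    · exact hσ.subst f fun ρ hρ => ⟨(hf ρ hρ).1, (hf ρ hρ).2.1, congrArg Prod.fst (hf ρ hρ).2.2⟩
    · exact hτ.subst f fun ρ hρ => ⟨(hf ρ hρ).1, (hf ρ hρ).2.1, congrArg Prod.snd (hf ρ hρ).2.2⟩
    · rw [hsize ρ hρ]
      exact Idx.hasValue_sum (hI ρ hρ) fun a ha => hJ _ (cons_mem_extend.2 ⟨hρ, ha⟩)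

/-! ### Intrinsically typed terms -/

/-- Typed de Bruijn indices. -/
inductive Var : List PTy → PTy → Type
  | zero {Γ : List PTy} {α : PTy} : Var (α :: Γ) α
  | succ {Γ : List PTy} {α β : PTy} (x : Var Γ α) : Var (β :: Γ) α

def Var.toNat : {Γ : List PTy} → {α : PTy} → Var Γ α → ℕ
  | _, _, .zero => 0
  | _, _, .succ x => x.toNat + 1

/-- Church-style terms of PCF: a term together with its simple typing. Fixing the simple types of
all subterms makes the semantic derivations of one term comparable with each other. -/
inductive TTerm : List PTy → PTy → Type
  | var {Γ : List PTy} {α : PTy} (x : Var Γ α) : TTerm Γ α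
  | num {Γ : List PTy} (n : ℕ) : TTerm Γ .nat
  | lam {Γ : List PTy} {α β : PTy} (t : TTerm (α :: Γ) β) : TTerm Γ (.arr α β)
  | fix {Γ : List PTy} {α β : PTy} (t : TTerm (.arr α β :: Γ) (.arr α β)) : TTerm Γ (.arr α β)
  | app {Γ : List PTy} {α β : PTy} (t : TTerm Γ (.arr α β)) (u : TTerm Γ α) : TTerm Γ β
  | succ {Γ : List PTy} (t : TTerm Γ .nat) : TTerm Γ .nat
  | pred {Γ : List PTy} (t : TTerm Γ .nat) : TTerm Γ .nat
  | ifz {Γ : List PTy} {α : PTy} (t : TTerm Γ .nat) (u s : TTerm Γ α) : TTerm Γ α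

def TTerm.erase : {Γ : List PTy} → {α : PTy} → TTerm Γ α → Term
  | _, _, .var x => .var x.toNat
  | _, _, .num n => .num n
  | _, _, .lam t => .lam t.erase
  | _, _, .fix t => .fix t.erase
  | _, _, .app t u => .app t.erase u.erase
  | _, _, .succ t => .succ t.erase
  | _, _, .pred t => .pred t.erase
  | _, _, .ifz t u s => .ifz t.erase u.erase s.erase

theorem Var.exists_toNat_eq {Γ : List PTy} {x : ℕ} {α : PTy} (h : Γ[x]? = some α) :
    ∃ y : Var Γ α, y.toNat = x := by
  induction Γ generalizing x with
  | nil => simp at h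
  | cons β Γ ih =>
    cases x with
    | zero =>
      obtain rfl : β = α := by simpa using h
      exact ⟨.zero, rfl⟩
    | succ x =>
      obtain ⟨y, rfl⟩ := ih (by simpa using h)
      exact ⟨.succ y, rfl⟩

theorem PCFTyping.exists_erase_eq {Γ : List PTy} {t : Term} {α : PTy} (h : PCFTyping Γ t α) :
    ∃ t' : TTerm Γ α, t'.erase = t := by
  induction h with
  | var h =>
    obtain ⟨y, rfl⟩ := Var.exists_toNat_eq h
    exact ⟨.var y, rfl⟩
  | num n => exact ⟨.num n, rfl⟩
  | lam _ ih =>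
    obtain ⟨t, rfl⟩ := ih
    exact ⟨.lam t, rfl⟩
  | fix _ ih =>
    obtain ⟨t, rfl⟩ := ih
    exact ⟨.fix t, rfl⟩
  | app _ _ ih ih' =>
    obtain ⟨t, rfl⟩ := ih
    obtain ⟨u, rfl⟩ := ih'
    exact ⟨.app t u, rfl⟩
  | succ _ ih =>
    obtain ⟨t, rfl⟩ := ih
    exact ⟨.succ t, rfl⟩
  | pred _ ih =>
    obtain ⟨t, rfl⟩ := ih
    exact ⟨.pred t, rfl⟩
  | ifz _ _ _ ih ih' ih'' =>
    obtain ⟨t, rfl⟩ := ih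
    obtain ⟨u, rfl⟩ := ih'
    obtain ⟨s, rfl⟩ := ih''
    exact ⟨.ifz t u s, rfl⟩

/-! ### Semantic contexts and derivations -/

/-- Assignments of points to the typed variables of a context. -/
def SCtx (Γ : List PTy) : Type := (α : PTy) → Var Γ α → α.Sem

instance (Γ : List PTy) : Inhabited (SCtx Γ) := ⟨fun _ _ => default⟩

def SCtx.cons {Γ : List PTy} {α : PTy} (s : α.Sem) (G : SCtx Γ) : SCtx (α :: Γ)
  | _, .zero => s
  | _, .succ x => G _ x

/-- Sums of semantic contexts, variable by variable. -/
def SCtx.IsSum {Γ : List PTy} (Gs : List (SCtx Γ)) (G : SCtx Γ) : Prop :=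
  ∀ (α : PTy) (x : Var Γ α), DlPCF.IsSum α (Gs.map fun G' => G' α x) (G α x)

/-- The data of one unfolding of a recursive function `fix t`: the use `type` that is made of this
unfolding, the list `children` of the uses that it makes of the recursive function, and the context
and the weight of the derivation for the body `t`. -/
structure Node (Γ : List PTy) (α β : PTy) : Type where
  children : List (α.Sem × β.Sem)
  type : α.Sem × β.Sem
  ctx : SCtx Γ
  weight : ℕ

instance (Γ : List PTy) (α β : PTy) : Inhabited (Node Γ α β) := ⟨⟨[], default, default, 0⟩⟩

/-- `IsForest P l ns`: there is a forest of nodes satisfying `P`, with the nodes `ns` in pre-order,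
whose roots have the types `l`, and where the types of the children of each node `ν` are
`ν.children`. -/
inductive IsForest {Γ : List PTy} {α β : PTy} (P : Node Γ α β → Prop) :
    List (α.Sem × β.Sem) → List (Node Γ α β) → Prop
  | nil : IsForest P [] []
  | cons {ν : Node Γ α β} {l : List (α.Sem × β.Sem)} {ns ms : List (Node Γ α β)} :
      P ν → IsForest P ν.children ns → IsForest P l ms → IsForest P (ν.type :: l) (ν :: (ns ++ ms))

/-- `t.Deriv G w s`: the term `t` has the point `s`, with weight `w`, in the semantic context `G`.
This is the type system at one fixed assignment of the index variables: the type derivations for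
the copies of a function under `[a < I]` become a list of unrelated derivations. -/
def TTerm.Deriv : {Γ : List PTy} → {α : PTy} → TTerm Γ α → SCtx Γ → ℕ → α.Sem → Prop
  | _, α, .var x, G, w, s => w = 0 ∧ G α x = s
  | _, _, .num n, _, w, s => w = 0 ∧ s = n
  | Γ, _, .lam (α := α) (β := β) t, G, w, s =>
      ∃ ns : List (SCtx Γ × ℕ),
        List.Forall₂ (fun (p : α.Sem × β.Sem) ν => t.Deriv (ν.1.cons p.1) ν.2 p.2) s ns ∧
        SCtx.IsSum (ns.map Prod.fst) G ∧ w = ns.length + (ns.map Prod.snd).sum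
  | Γ, _, .fix (α := α) (β := β) t, G, w, s =>
      ∃ ns : List (Node Γ α β),
        IsForest (fun ν => t.Deriv (ν.ctx.cons (α := .arr α β) ν.children) ν.weight
          (PTy.Sem.single ν.type)) s ns ∧
        SCtx.IsSum (ns.map Node.ctx) G ∧ w = ns.length + (ns.map Node.weight).sum
  | Γ, _, .app (α := α) t u, G, w, s =>
      ∃ (r : α.Sem) (G₁ G₂ : SCtx Γ) (w₁ w₂ : ℕ), t.Deriv G₁ w₁ (PTy.Sem.single (r, s)) ∧
        u.Deriv G₂ w₂ r ∧ SCtx.IsSum [G₁, G₂] G ∧ w = w₁ + w₂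
  | _, _, .succ t, G, w, s => ∃ n : ℕ, t.Deriv G w n ∧ s = n + 1
  | _, _, .pred t, G, w, s => ∃ n : ℕ, t.Deriv G w n ∧ s = n - 1
  | Γ, _, .ifz t u s, G, w, r =>
      ∃ (n : ℕ) (G₁ G₂ : SCtx Γ) (w₁ w₂ : ℕ), t.Deriv G₁ w₁ n ∧
        (n = 0 → u.Deriv G₂ w₂ r) ∧ (n ≠ 0 → s.Deriv G₂ w₂ r) ∧
        SCtx.IsSum [G₁, G₂] G ∧ w = w₁ + w₂

/-- The pre-order numbering of a forest, where the number of a node's children is `κ`: from the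
start `o`, the forest cardinalities count the nodes, and they locate the roots and, for every node,
its children. -/
theorem IsForest.forestCard {Γ : List PTy} {α β : PTy} {P : Node Γ α β → Prop}
    {l : List (α.Sem × β.Sem)} {ns : List (Node Γ α β)} (h : IsForest P l ns) (o : ℕ)
    {κ : ℕ → ℕ → Prop} (hκ : ∀ i ν, ns[i]? = some ν → κ (o + i) ν.children.length) :
    ForestCard κ o l.length ns.length ∧
    (∀ a p, l[a]? = some p → ∃ i ν, ns[i]? = some ν ∧ ν.type = p ∧ ForestCard κ o a i) ∧
    ∀ i ν, ns[i]? = some ν → P ν ∧ ∀ a p, ν.children[a]? = some p →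
      ∃ j μ, ns[i + 1 + j]? = some μ ∧ μ.type = p ∧ ForestCard κ (o + i + 1) a j := by
  induction h generalizing o with
  | nil => exact ⟨.zero o, by simp, by simp⟩
  | @cons ν l ns ms hν _ _ ih₁ ih₂ =>
    have hns : ∀ i μ, ns[i]? = some μ → (ν :: (ns ++ ms))[i + 1]? = some μ := fun i μ hi => by
      rw [List.getElem?_cons_succ, List.getElem?_append_left (List.getElem?_eq_some_iff.1 hi).1, hi]
    have hms : ∀ i μ, ms[i]? = some μ → (ν :: (ns ++ ms))[ns.length + 1 + i]? = some μ :=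
      fun i μ hi => by
        rw [show ns.length + 1 + i = ns.length + i + 1 by omega, List.getElem?_cons_succ,
          List.getElem?_append_right (by omega), Nat.add_sub_cancel_left, hi]
    obtain ⟨hc₁, hr₁, hn₁⟩ := ih₁ (o + 1) fun i μ hi => by
      rw [show o + 1 + i = o + (i + 1) by omega]
      exact hκ _ _ (hns _ _ hi)
    obtain ⟨hc₂, hr₂, hn₂⟩ := ih₂ (o + (ns.length + 1)) fun i μ hi => by
      rw [show o + (ns.length + 1) + i = o + (ns.length + 1 + i) by omega]
      exact hκ _ _ (hms _ _ hi)
    have hroot : ForestCard κ o 1 (ns.length + 1) := by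
      have := ForestCard.succ (ForestCard.zero o) (hκ 0 ν rfl) hc₁
      rwa [show 0 + 1 + ns.length = ns.length + 1 by omega] at this
    refine ⟨?_, fun a p ha => ?_, fun i μ hi => ?_⟩
    · have := hroot.append hc₂
      rw [List.length_cons, List.length_cons, List.length_append, add_comm l.length]
      rwa [show ns.length + ms.length + 1 = ns.length + 1 + ms.length by omega]
    · cases a with
      | zero => exact ⟨0, ν, rfl, by simpa using ha, .zero o⟩
      | succ a =>
        obtain ⟨i, μ, hi, hμ, hc⟩ := hr₂ a p (by simpa using ha)
        refine ⟨_, μ, hms _ _ hi, hμ, ?_⟩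
        rw [add_comm a]
        exact hroot.append hc
    · cases i with
      | zero =>
        obtain rfl : ν = μ := by simpa using hi
        refine ⟨hν, fun a p ha => ?_⟩
        obtain ⟨j, μ, hj, hμ, hc⟩ := hr₁ a p ha
        exact ⟨j, μ, by rw [show 0 + 1 + j = j + 1 by omega]; exact hns _ _ hj, hμ, hc⟩
      | succ i =>
        rw [List.getElem?_cons_succ] at hi
        rcases lt_or_ge i ns.length with hlt | hge
        · rw [List.getElem?_append_left hlt] at hi
          refine (hn₁ i μ hi).imp_right fun H a p ha => ?_
          obtain ⟨j, μ', hj, hμ', hc⟩ := H a p ha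
          refine ⟨j, μ', ?_, hμ', ?_⟩
          · rw [show i + 1 + 1 + j = i + 1 + j + 1 by omega]
            exact hns _ _ hj
          · rwa [show o + (i + 1) + 1 = o + 1 + i + 1 by omega]
        · rw [List.getElem?_append_right hge] at hi
          refine (hn₂ _ μ hi).imp_right fun H a p ha => ?_
          obtain ⟨j, μ', hj, hμ', hc⟩ := H a p ha
          refine ⟨j, μ', ?_, hμ', ?_⟩
          · rw [show i + 1 + 1 + j = ns.length + 1 + (i - ns.length + 1 + j) by omega]
            exact hms _ _ hj
          · rwa [show o + (i + 1) + 1 = o + (ns.length + 1) + (i - ns.length) + 1 by omega]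

theorem IsForest.append {Γ : List PTy} {α β : PTy} {P : Node Γ α β → Prop}
    {l l' : List (α.Sem × β.Sem)} {ns ns' : List (Node Γ α β)} (h : IsForest P l ns)
    (h' : IsForest P l' ns') : IsForest P (l ++ l') (ns ++ ns') := by
  induction h with
  | nil => exact h'
  | cons hν h₁ _ _ ih =>
    rw [List.cons_append, List.cons_append, List.append_assoc]
    exact .cons hν h₁ ih

/-! ### Typed syntactic contexts -/

/-- Assignments of modal types to the variables of a simple typing context. -/
def MCtx (Θ : ℕ → Type u) (k : ℕ) (Γ : List PTy) : Type u := (α : PTy) → Var Γ α → MType Θ k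

def MCtx.cons {k : ℕ} {Γ : List PTy} {α : PTy} (σ : MType Θ k) (M : MCtx Θ k Γ) :
    MCtx Θ k (α :: Γ)
  | _, .zero => σ
  | _, .succ x => M _ x

/-- The underlying context, which is undefined outside of `Γ`. -/
def MCtx.toCtx {k : ℕ} : {Γ : List PTy} → MCtx Θ k Γ → Ctx Θ k
  | [], _ => Ctx.empty
  | _ :: _, M => Ctx.cons (M _ .zero) (MCtx.toCtx fun _ x => M _ (.succ x))

theorem MCtx.toCtx_toNat {k : ℕ} {Γ : List PTy} {α : PTy} (M : MCtx Θ k Γ) (x : Var Γ α) :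
    M.toCtx x.toNat = some (M α x) := by
  induction x with
  | zero => rfl
  | succ x ih => exact ih _

theorem MCtx.rel_toCtx {k l : ℕ} {R : MType Θ k → MType Θ l → Prop} {Γ : List PTy}
    {M : MCtx Θ k Γ} {M' : MCtx Θ l Γ} (h : ∀ α x, R (M α x) (M' α x)) (y : ℕ) :
    Option.Rel R (M.toCtx y) (M'.toCtx y) := by
  induction Γ generalizing y with
  | nil => exact .none
  | cons α Γ ih =>
    cases y with
    | zero => exact .some (h _ _)
    | succ y => exact ih (fun _ x => h _ (.succ x)) y

theorem MCtx.ctxSum_toCtx {k : ℕ} {Γ : List PTy} {M M' M'' : MCtx Θ k Γ}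
    (h : ∀ α x, MSum (M α x) (M' α x) (M'' α x)) : CtxSum M.toCtx M'.toCtx M''.toCtx := by
  intro y
  induction Γ generalizing y with
  | nil => exact .none
  | cons α Γ ih =>
    cases y with
    | zero => exact .both (h _ _)
    | succ y => exact ih (fun _ x => h _ (.succ x)) y

/-- `M` represents the family `G` of semantic contexts on `S`, variable by variable. -/
def MCtx.Represents (φ : Interp Θ) {k : ℕ} {Γ : List PTy} (S : Set (Fin k → ℕ))
    (M : MCtx Θ k Γ) (G : (Fin k → ℕ) → SCtx Γ) : Prop :=
  ∀ α x, DlPCF.Represents φ S α (M α x) fun ρ => G ρ α x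

theorem MCtx.Represents.cons {k : ℕ} {Γ : List PTy} {S : Set (Fin k → ℕ)}
    {M : MCtx Θ k Γ} {G : (Fin k → ℕ) → SCtx Γ} (hM : M.Represents φ S G) {α : PTy}
    {σ : MType Θ k} {T : (Fin k → ℕ) → α.Sem} (hσ : DlPCF.Represents φ S α σ T) :
    (M.cons σ).Represents φ S fun ρ => (G ρ).cons (T ρ)
  | _, .zero => hσ
  | _, .succ x => hM _ x

theorem MCtx.Represents.sub {k : ℕ} {Γ : List PTy} {Φ : ICtx Θ k}
    {M M' : MCtx Θ k Γ} {G : (Fin k → ℕ) → SCtx Γ} (hM : M.Represents φ (Φ.models φ) G)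
    (hM' : M'.Represents φ (Φ.models φ) G) : CtxSub φ Φ M.toCtx M'.toCtx :=
  MCtx.rel_toCtx fun α x => (hM α x).sub (hM' α x)

theorem MCtx.Represents.mono {k : ℕ} {Γ : List PTy} {S S' : Set (Fin k → ℕ)}
    {M : MCtx Θ k Γ} {G : (Fin k → ℕ) → SCtx Γ} (hM : M.Represents φ S G) (h : S' ⊆ S) :
    M.Represents φ S' G :=
  fun α x => (hM α x).congr fun _ hρ => ⟨h hρ, rfl⟩

theorem Interp.Universal.exists_ctxSum (hU : φ.Universal) {Γ : List PTy} {k : ℕ}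
    {S : Set (Fin k → ℕ)} (hS : S.Finite) {F G H : (Fin k → ℕ) → SCtx Γ}
    (h : ∀ ρ ∈ S, SCtx.IsSum [F ρ, G ρ] (H ρ)) :
    ∃ M₁ M₂ M : MCtx Θ k Γ, CtxSum M₁.toCtx M₂.toCtx M.toCtx ∧ M₁.Represents φ S F ∧
      M₂.Represents φ S G ∧ M.Represents φ S H := by
  choose M₁ M₂ M hM h₁ h₂ h₃ using fun α (x : Var Γ α) =>
    hU.exists_mSum hS fun ρ hρ => h ρ hρ α x
  exact ⟨M₁, M₂, M, MCtx.ctxSum_toCtx hM, h₁, h₂, h₃⟩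

theorem Interp.Universal.exists_ctxBSum (hU : φ.Universal) {Γ : List PTy} {k : ℕ}
    {S : Set (Fin k → ℕ)} (hS : S.Finite) {I : Idx Θ k} {N : (Fin k → ℕ) → ℕ}
    (hI : ∀ ρ ∈ S, I.HasValue φ ρ (N ρ)) {F : (Fin (k + 1) → ℕ) → SCtx Γ}
    {H : (Fin k → ℕ) → SCtx Γ}
    (h : ∀ ρ ∈ S, SCtx.IsSum ((List.range (N ρ)).map fun a => F (Fin.cons a ρ)) (H ρ)) :
    ∃ (M' : MCtx Θ (k + 1) Γ) (M : MCtx Θ k Γ), CtxBSum I M'.toCtx M.toCtx ∧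
      M'.Represents φ (extend S N) F ∧ M.Represents φ S H := by
  choose M' M hM h₁ h₂ using fun α (x : Var Γ α) =>
    hU.exists_bSum hS hI (F := fun ρ => F ρ α x) (H := fun ρ => H ρ α x) fun ρ hρ => by
      simpa [Function.comp_def] using h ρ hρ α x
  exact ⟨M', M, MCtx.rel_toCtx hM, h₁, h₂⟩

/-! ### Uniformization -/

theorem map_range_getD {X Y : Type*} (l : List X) (d : X) (f : X → Y) :
    ((List.range l.length).map fun i => f (l.getD i d)) = l.map f := by
  refine List.ext_getElem (by simp) fun i h₁ h₂ => ?_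
  have : i < l.length := by simpa using h₁
  simp [this]

theorem sum_range_getD {X : Type*} (l : List X) (d : X) (f : X → ℕ) :
    ∑ i ∈ Finset.range l.length, f (l.getD i d) = (l.map f).sum := by
  rw [← map_range_getD l d f]
  simp [Finset.sum, Finset.range, Multiset.range]

/-- A term is uniform if every finite family of its semantic derivations, indexed by the models of
an index context, is the family of meanings of a single type derivation. -/
def Uniform (φ : Interp Θ) {Γ : List PTy} {α : PTy} (t : TTerm Γ α) : Prop :=
  ∀ ⦃k : ℕ⦄ (Φ : ICtx Θ k), (Φ.models φ).Finite →
    ∀ (G : (Fin k → ℕ) → SCtx Γ) (w : (Fin k → ℕ) → ℕ) (T : (Fin k → ℕ) → α.Sem),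
    (∀ ρ ∈ Φ.models φ, t.Deriv (G ρ) (w ρ) (T ρ)) →
    ∃ (M : MCtx Θ k Γ) (W : Idx Θ k) (τ : MType Θ k), Typing φ Φ M.toCtx W t.erase τ ∧
      M.Represents φ (Φ.models φ) G ∧ (∀ ρ ∈ Φ.models φ, W.HasValue φ ρ (w ρ)) ∧
      Represents φ (Φ.models φ) α τ T

/-- By subtyping, the family has a type derivation for every choice of a context, a weight and a
type that represent it. -/
theorem Uniform.typing {Γ : List PTy} {α : PTy} {t : TTerm Γ α} (ht : Uniform φ t) {k : ℕ}
    {Φ : ICtx Θ k} (hΦ : (Φ.models φ).Finite) {G : (Fin k → ℕ) → SCtx Γ}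
    {w : (Fin k → ℕ) → ℕ} {T : (Fin k → ℕ) → α.Sem}
    (hd : ∀ ρ ∈ Φ.models φ, t.Deriv (G ρ) (w ρ) (T ρ)) {M : MCtx Θ k Γ} {W : Idx Θ k}
    {τ : MType Θ k} (hM : M.Represents φ (Φ.models φ) G)
    (hW : ∀ ρ ∈ Φ.models φ, W.HasValue φ ρ (w ρ)) (hτ : Represents φ (Φ.models φ) α τ T) :
    Typing φ Φ M.toCtx W t.erase τ := by
  obtain ⟨M', W', τ', h, hM', hW', hτ'⟩ := ht Φ hΦ G w T hd
  exact h.sub (hM.sub hM') (hτ'.sub hτ) (.of_hasValue hW' hW)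

variable {Γ : List PTy} {α β : PTy}

theorem uniform_var (hU : φ.Universal) (x : Var Γ α) : Uniform φ (.var x) := by
  intro k Φ hΦ G w T hd
  choose M hM using fun β (y : Var Γ β) => hU.exists_represents hΦ fun ρ => G ρ β y
  refine ⟨M, .zero, M α x, .var (MCtx.toCtx_toNat M x), hM, fun ρ hρ => (hd ρ hρ).1, ?_⟩
  exact (hM α x).congr fun ρ hρ => ⟨hρ, (hd ρ hρ).2⟩

theorem uniform_num (hU : φ.Universal) (n : ℕ) : Uniform φ (.num n : TTerm Γ .nat) := by
  intro k Φ hΦ G w T hd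
  choose M hM using fun β (y : Var Γ β) => hU.exists_represents hΦ fun ρ => G ρ β y
  refine ⟨M, .zero, _, .num n, hM, fun ρ hρ => (hd ρ hρ).1, fun ρ hρ => ?_⟩
  rw [(hd ρ hρ).2]
  exact ⟨Idx.hasValue_numeral n ρ, Idx.hasValue_numeral n ρ⟩

theorem uniform_lam (hU : φ.Universal) {t : TTerm (α :: Γ) β} (ht : Uniform φ t) :
    Uniform φ t.lam := by
  intro k Φ hΦ G w T hd
  choose! ns hns hG hw using hd
  obtain ⟨τ, hτ⟩ := hU.exists_represents hΦ T
  cases τ with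
  | nat => exact hτ.elim
  | bang I σ τ =>
    have hsize : ∀ ρ ∈ Φ.models φ, (T ρ).size = (ns ρ).length := fun ρ hρ =>
      (hns ρ hρ).length_eq
    have hbind := ICtx.models_bind hτ.1
    have hfin : ((Φ.bind I).models φ).Finite := hbind ▸ finite_extend hΦ _
    let ν : (Fin (k + 1) → ℕ) → SCtx Γ × ℕ := fun ρ => (ns (Fin.tail ρ)).getD (ρ 0) default
    obtain ⟨M', M, hMM, hM', hM⟩ := hU.exists_ctxBSum hΦ hτ.1 (F := fun ρ => (ν ρ).1) (H := G)
      fun ρ hρ => by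
        rw [hsize ρ hρ]
        exact map_range_getD (ns ρ) default Prod.fst ▸ hG ρ hρ
    obtain ⟨W, hW⟩ := hU.exists_idx hfin fun ρ => (ν ρ).2
    have hbody : ∀ ρ ∈ (Φ.bind I).models φ, t.Deriv
        ((ν ρ).1.cons ((T (Fin.tail ρ)).entry (ρ 0)).1) (ν ρ).2
        ((T (Fin.tail ρ)).entry (ρ 0)).2 := by
      intro ρ hρ
      rw [hbind] at hρ
      obtain ⟨hρ, ha⟩ := hρ
      have h₁ : ρ 0 < List.length (T (Fin.tail ρ)) := ha
      have h₂ : ρ 0 < (ns (Fin.tail ρ)).length := (hsize _ hρ).symm ▸ ha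
      have := (hns _ hρ).get h₁ h₂
      simp only [ν, PTy.Sem.entry, List.getD_eq_getElem _ _ h₁, List.getD_eq_getElem _ _ h₂]
      exact this
    rw [← hbind] at hM'
    refine ⟨M, _, _, .lam (Γ := M'.toCtx)
      (ht.typing hfin hbody (M := M'.cons σ) (hM'.cons ?_) hW ?_) hMM, hM, fun ρ hρ => ?_, hτ⟩
    · exact hbind ▸ hτ.2.1
    · exact hbind ▸ hτ.2.2
    · refine ⟨_, _, hτ.1 ρ hρ, Idx.hasValue_sum (hτ.1 ρ hρ) fun a ha => hW _ ?_, ?_⟩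
      · exact hbind ▸ cons_mem_extend.2 ⟨hρ, ha⟩
      · rw [hw ρ hρ, hsize ρ hρ]
        exact congrArg _ (sum_range_getD (ns ρ) default Prod.snd).symm

theorem uniform_app (hU : φ.Universal) {t : TTerm Γ (.arr α β)} {u : TTerm Γ α}
    (ht : Uniform φ t) (hu : Uniform φ u) : Uniform φ (t.app u) := by
  intro k Φ hΦ G w T hd
  choose! r G₁ G₂ w₁ w₂ ht' hu' hG hw using hd
  obtain ⟨M₁, M₂, M, hMM, hM₁, hM₂, hM⟩ := hU.exists_ctxSum hΦ hG
  obtain ⟨W₁, hW₁⟩ := hU.exists_idx hΦ w₁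
  obtain ⟨W₂, hW₂⟩ := hU.exists_idx hΦ w₂
  have hfin := finite_extend hΦ fun _ => 1
  obtain ⟨σ, hσ⟩ := hU.exists_represents hfin fun ρ => r (Fin.tail ρ)
  obtain ⟨τ, hτ⟩ := hU.exists_represents hfin fun ρ => T (Fin.tail ρ)
  have hzero : ∀ ρ ∈ extend (Φ.models φ) fun _ => 1, ρ 0 = 0 := fun ρ hρ =>
    Nat.lt_one_iff.1 hρ.2
  have hσ₀ : Represents φ (Φ.models φ) α (σ.inst .zero) r :=
    hσ.inst_zero fun ρ hρ => ⟨cons_mem_extend.2 ⟨hρ, one_pos⟩, rfl⟩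
  have hτ₀ : Represents φ (Φ.models φ) β (τ.inst .zero) T :=
    hτ.inst_zero fun ρ hρ => ⟨cons_mem_extend.2 ⟨hρ, one_pos⟩, rfl⟩
  have hfun : Represents φ (Φ.models φ) (.arr α β) (.bang .one σ τ)
      fun ρ => PTy.Sem.single (r ρ, T ρ) :=
    ⟨fun _ _ => rfl, hσ.congr fun ρ hρ => ⟨hρ, by rw [hzero ρ hρ, PTy.Sem.entry_single]⟩,
      hτ.congr fun ρ hρ => ⟨hρ, by rw [hzero ρ hρ, PTy.Sem.entry_single]⟩⟩
  exact ⟨M, _, _, .app (ht.typing hΦ ht' hM₁ hW₁ hfun) (hu.typing hΦ hu' hM₂ hW₂ hσ₀) hMM, hM,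
    fun ρ hρ => ⟨_, _, hW₁ ρ hρ, hW₂ ρ hρ, hw ρ hρ⟩, hτ₀⟩

theorem uniform_succ (hU : φ.Universal) {t : TTerm Γ .nat} (ht : Uniform φ t) :
    Uniform φ t.succ := by
  intro k Φ hΦ G w T hd
  choose! n ht' hT using hd
  choose M hM using fun β (y : Var Γ β) => hU.exists_represents hΦ fun ρ => G ρ β y
  obtain ⟨W, hW⟩ := hU.exists_idx hΦ w
  obtain ⟨I, hI⟩ := hU.exists_idx hΦ n
  have hI' : ∀ ρ ∈ Φ.models φ, (Idx.add I .one).HasValue φ ρ (T ρ) := fun ρ hρ =>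
    ⟨_, _, hI ρ hρ, rfl, hT ρ hρ⟩
  exact ⟨M, W, _, .succ (ht.typing hΦ ht' hM hW (τ := .nat I I) fun ρ hρ => ⟨hI ρ hρ, hI ρ hρ⟩),
    hM, hW, fun ρ hρ => ⟨hI' ρ hρ, hI' ρ hρ⟩⟩

theorem uniform_pred (hU : φ.Universal) {t : TTerm Γ .nat} (ht : Uniform φ t) :
    Uniform φ t.pred := by
  intro k Φ hΦ G w T hd
  choose! n ht' hT using hd
  choose M hM using fun β (y : Var Γ β) => hU.exists_represents hΦ fun ρ => G ρ β y
  obtain ⟨W, hW⟩ := hU.exists_idx hΦ w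
  obtain ⟨I, hI⟩ := hU.exists_idx hΦ n
  have hI' : ∀ ρ ∈ Φ.models φ, (Idx.monus I .one).HasValue φ ρ (T ρ) := fun ρ hρ =>
    ⟨_, _, hI ρ hρ, rfl, hT ρ hρ⟩
  exact ⟨M, W, _, .pred (ht.typing hΦ ht' hM hW (τ := .nat I I) fun ρ hρ => ⟨hI ρ hρ, hI ρ hρ⟩),
    hM, hW, fun ρ hρ => ⟨hI' ρ hρ, hI' ρ hρ⟩⟩

theorem ICtx.models_cons_subset {k : ℕ} (c : Constraint Θ k) (Φ : ICtx Θ k) :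
    ICtx.models φ (c :: Φ) ⊆ Φ.models φ :=
  fun _ hρ d hd => hρ d (List.mem_cons_of_mem _ hd)

theorem uniform_ifz (hU : φ.Universal) {t : TTerm Γ .nat} {u s : TTerm Γ α}
    (ht : Uniform φ t) (hu : Uniform φ u) (hs : Uniform φ s) : Uniform φ (t.ifz u s) := by
  intro k Φ hΦ G w T hd
  choose! n G₁ G₂ w₁ w₂ ht' hu' hs' hG hw using hd
  obtain ⟨M₁, M₂, M, hMM, hM₁, hM₂, hM⟩ := hU.exists_ctxSum hΦ hG
  obtain ⟨W₁, hW₁⟩ := hU.exists_idx hΦ w₁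
  obtain ⟨W₂, hW₂⟩ := hU.exists_idx hΦ w₂
  obtain ⟨I, hI⟩ := hU.exists_idx hΦ n
  obtain ⟨τ, hτ⟩ := hU.exists_represents hΦ T
  have hzero := ICtx.models_cons_subset (φ := φ) ⟨I, .zero⟩ Φ
  have hone := ICtx.models_cons_subset (φ := φ) ⟨.one, I⟩ Φ
  refine ⟨M, _, τ, .ifz (J := I) (K := I)
    (ht.typing hΦ ht' hM₁ hW₁ fun ρ hρ => ⟨hI ρ hρ, hI ρ hρ⟩)
    (hu.typing (hΦ.subset hzero) (fun ρ hρ => hu' ρ (hzero hρ) ?_) (hM₂.mono hzero)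
      (fun ρ hρ => hW₂ ρ (hzero hρ)) (hτ.congr fun ρ hρ => ⟨hzero hρ, rfl⟩))
    (hs.typing (hΦ.subset hone) (fun ρ hρ => hs' ρ (hone hρ) ?_) (hM₂.mono hone)
      (fun ρ hρ => hW₂ ρ (hone hρ)) (hτ.congr fun ρ hρ => ⟨hone hρ, rfl⟩)) hMM, hM,
    fun ρ hρ => ⟨_, _, hW₁ ρ hρ, hW₂ ρ hρ, hw ρ hρ⟩, hτ⟩
  -- the constraint of either branch decides whether the tested number is `0`
  · obtain ⟨x, y, hx, rfl, hxy⟩ := hρ _ List.mem_cons_self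
    have := hx.unique (hI ρ (hzero hρ))
    omega
  · obtain ⟨x, y, rfl, hy, hxy⟩ := hρ _ List.mem_cons_self
    have := hy.unique (hI ρ (hone hρ))
    omega

theorem uniform_fix (hU : φ.Universal) {t : TTerm (.arr α β :: Γ) (.arr α β)}
    (ht : Uniform φ t) : Uniform φ t.fix := by
  intro k Φ hΦ G w T hd
  choose! ns hns hG hw using hd
  let S := Φ.models φ
  let N : (Fin k → ℕ) → ℕ := fun ρ => (ns ρ).length
  -- the node `b`, at the assignment `b, ρ`
  let ν : (Fin (k + 1) → ℕ) → Node Γ α β := fun ρ => (ns (Fin.tail ρ)).getD (ρ 0) default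
  have hν : ∀ ρ b μ, (ns ρ)[b]? = some μ → b < N ρ ∧ ν (Fin.cons b ρ) = μ := fun ρ b μ h => by
    obtain ⟨hb, rfl⟩ := List.getElem?_eq_some_iff.1 h
    exact ⟨hb, List.getD_eq_getElem _ _ hb⟩
  have hfin : (extend S N).Finite := finite_extend hΦ N
  let C : (Fin (k + 1) → ℕ) → ℕ := fun ρ => (ν ρ).children.length
  obtain ⟨I, hI⟩ := hU.exists_idx hfin C
  obtain ⟨K, hK⟩ := hU.exists_idx hΦ fun ρ => (T ρ).size
  obtain ⟨W, hW⟩ := hU.exists_idx hfin fun ρ => (ν ρ).weight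
  let κ : (Fin k → ℕ) → ℕ → ℕ → Prop := fun ρ i c =>
    I.HasValue φ (Fin.cons i ρ : Fin (k + 1) → ℕ) c
  have hforest : ∀ ρ ∈ S, _ := fun ρ (hρ : ρ ∈ S) =>
    (hns ρ hρ).forestCard 0 (κ := κ ρ) fun i μ hi => by
      obtain ⟨hlt, rfl⟩ := hν _ _ _ hi
      rw [zero_add]
      exact hI _ (cons_mem_extend.2 ⟨hρ, hlt⟩)
  -- `K` counts the roots and `I` the children, so this counts the nodes
  let H : Idx Θ k := .forest .zero K I
  have hH : ∀ ρ ∈ Φ.models φ, H.HasValue φ ρ (N ρ) := fun ρ hρ =>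
    ⟨_, _, rfl, hK ρ hρ, (hforest ρ hρ).1⟩
  have hbind : (Φ.bind H).models φ = extend S N := ICtx.models_bind hH
  have hbind' : ((Φ.bind H).bind I).models φ = extend (extend S N) C := by
    rw [← hbind] at hI ⊢
    exact ICtx.models_bind hI
  -- the number of the `a`-th root, and of the `a`-th child of the node `b`
  have hroot : ∀ ρ ∈ extend S fun ρ => (T ρ).size, ∃ i, i < N (Fin.tail ρ) ∧
      (ν (Fin.cons i (Fin.tail ρ))).type = (T (Fin.tail ρ)).entry (ρ 0) ∧
      ForestCard (κ (Fin.tail ρ)) 0 (ρ 0) i := by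
    rintro ρ ⟨hρ, ha⟩
    obtain ⟨i, μ, hi, hμ, hc⟩ := (hforest _ hρ).2.1 (ρ 0) _ (List.getElem?_eq_getElem ha)
    obtain ⟨hlt, rfl⟩ := hν _ _ _ hi
    exact ⟨i, hlt, hμ.trans (List.getD_eq_getElem _ _ ha).symm, hc⟩
  have hnode : ∀ ρ ∈ extend S N, t.Deriv
      ((ν ρ).ctx.cons (α := .arr α β) (ν ρ).children) (ν ρ).weight
        (PTy.Sem.single (ν ρ).type) ∧
      ∀ a < C ρ, ∃ j, ρ 0 + 1 + j < N (Fin.tail ρ) ∧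
        (ν (Fin.cons (ρ 0 + 1 + j) (Fin.tail ρ))).type = (ν ρ).children.getD a default ∧
        ForestCard (κ (Fin.tail ρ)) (ρ 0 + 1) a j := by
    rintro ρ ⟨hρ, hb⟩
    obtain ⟨hD, hch⟩ := (hforest _ hρ).2.2 (ρ 0) (ν ρ)
      ((List.getElem?_eq_getElem hb).trans (congrArg some (List.getD_eq_getElem _ _ hb).symm))
    refine ⟨hD, fun a ha => ?_⟩
    obtain ⟨j, μ, hj, hμ, hc⟩ := hch a _ (List.getElem?_eq_getElem ha)
    obtain ⟨hlt, rfl⟩ := hν _ _ _ hj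
    exact ⟨j, hlt, hμ.trans (List.getD_eq_getElem _ _ ha).symm, by rwa [zero_add] at hc⟩
  have hchild : ∀ ρ ∈ extend (extend S N) C, ∃ j, ρ 1 + 1 + j < N (Fin.tail (Fin.tail ρ)) ∧
      (ν (Fin.cons (ρ 1 + 1 + j) (Fin.tail (Fin.tail ρ)))).type =
        (ν (Fin.tail ρ)).children.getD (ρ 0) default ∧
      ForestCard (κ (Fin.tail (Fin.tail ρ))) (ρ 1 + 1) (ρ 0) j := fun ρ hρ =>
    (hnode _ hρ.1).2 _ hρ.2
  choose! root hroot_lt hroot_type hroot_card using hroot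
  choose! child hchild_lt hchild_type hchild_card using hchild
  -- the result type `B` of the body, which does not depend on the variable of `[a < 1]`
  have hfin₁ := finite_extend hfin fun _ => 1
  obtain ⟨B₁, hB₁⟩ := hU.exists_represents hfin₁ fun ρ => (ν (Fin.tail ρ)).type.1
  obtain ⟨B₂, hB₂⟩ := hU.exists_represents hfin₁ fun ρ => (ν (Fin.tail ρ)).type.2
  have hB₁₀ : Represents φ (extend S N) α (B₁.inst .zero) fun ρ => (ν ρ).type.1 :=
    hB₁.inst_zero fun ρ hρ => ⟨cons_mem_extend.2 ⟨hρ, one_pos⟩, rfl⟩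
  have hB₂₀ : Represents φ (extend S N) β (B₂.inst .zero) fun ρ => (ν ρ).type.2 :=
    hB₂.inst_zero fun ρ hρ => ⟨cons_mem_extend.2 ⟨hρ, one_pos⟩, rfl⟩
  have hzero : ∀ ρ ∈ extend (extend S N) fun _ => 1, ρ 0 = 0 := fun ρ hρ =>
    Nat.lt_one_iff.1 hρ.2
  have hbody : Represents φ (extend S N) (.arr α β) (.box .one ⟨B₁, B₂⟩)
      fun ρ => PTy.Sem.single (ν ρ).type :=
    ⟨fun _ _ => rfl, hB₁.congr fun ρ hρ => ⟨hρ, by rw [hzero ρ hρ, PTy.Sem.entry_single]⟩,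
      hB₂.congr fun ρ hρ => ⟨hρ, by rw [hzero ρ hρ, PTy.Sem.entry_single]⟩⟩
  have hfin₂ := finite_extend hfin C
  obtain ⟨A₁, hA₁⟩ := hU.exists_represents hfin₂
    fun ρ => ((ν (Fin.tail ρ)).children.getD (ρ 0) default).1
  obtain ⟨A₂, hA₂⟩ := hU.exists_represents hfin₂
    fun ρ => ((ν (Fin.tail ρ)).children.getD (ρ 0) default).2
  have hrec : Represents φ (extend S N) (.arr α β) (.box I ⟨A₁, A₂⟩) fun ρ => (ν ρ).children :=
    ⟨hI, hA₁, hA₂⟩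
  obtain ⟨M', M, hMM, hM', hM⟩ := hU.exists_ctxBSum hΦ hH (F := fun ρ => (ν ρ).ctx) (H := G)
    fun ρ hρ => map_range_getD (ns ρ) default Node.ctx ▸ hG ρ hρ
  -- the assignments at which the two substitutions of the typing rule evaluate the type `B`
  let f : (Fin (k + 2) → ℕ) → Fin (k + 1) → ℕ := fun ρ =>
    Fin.cons (ρ 1 + 1 + child ρ) (Fin.tail (Fin.tail ρ))
  have hf : ∀ ρ ∈ extend (extend S N) C, f ρ ∈ extend S N ∧
      Idx.SubstValue φ (Fin.cases
          (.add (.add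
            (.forest (.add (.var 1) .one) (.var 0) (I.rename (liftRen (fun i => i.succ.succ))))
            (.var 1)) .one)
          (fun i => .var i.succ.succ)) ρ (f ρ) ∧
      (ν (f ρ)).type = (ν (Fin.tail ρ)).children.getD (ρ 0) default := by
    intro ρ hρ
    refine ⟨cons_mem_extend.2 ⟨hρ.1.1, hchild_lt ρ hρ⟩, fun i => ?_, hchild_type ρ hρ⟩
    induction i using Fin.cases with
    | zero =>
      refine ⟨child ρ + ρ 1, 1, ⟨_, _, ⟨_, _, ⟨_, _, rfl, rfl, rfl⟩, rfl, ?_⟩, rfl, rfl⟩, rfl, ?_⟩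
      · simp only [Idx.hasValue_rename, Idx.cons_comp_liftRen]
        exact hchild_card ρ hρ
      · simp only [f, Fin.cons_zero]
        omega
    | succ i => exact rfl
  let g : (Fin (k + 1) → ℕ) → Fin (k + 1) → ℕ := fun ρ => Fin.cons (root ρ) (Fin.tail ρ)
  have hg : ∀ ρ ∈ extend S fun ρ => (T ρ).size, g ρ ∈ extend S N ∧
      Idx.SubstValue φ (Fin.cases
          (.forest .zero (.var 0) (I.rename (liftRen Fin.succ)))
          (fun i => .var i.succ)) ρ (g ρ) ∧
      (ν (g ρ)).type = (T (Fin.tail ρ)).entry (ρ 0) := by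
    intro ρ hρ
    refine ⟨cons_mem_extend.2 ⟨hρ.1, hroot_lt ρ hρ⟩, fun i => ?_, hroot_type ρ hρ⟩
    induction i using Fin.cases with
    | zero =>
      refine ⟨_, _, rfl, rfl, ?_⟩
      simp only [Idx.hasValue_rename, Idx.cons_comp_liftRen]
      exact hroot_card ρ hρ
    | succ i => exact rfl
  have hA₁' := hB₁₀.subst f fun ρ hρ =>
    ⟨(hf ρ hρ).1, (hf ρ hρ).2.1, congrArg Prod.fst (hf ρ hρ).2.2⟩
  have hA₂' := hB₂₀.subst f fun ρ hρ =>
    ⟨(hf ρ hρ).1, (hf ρ hρ).2.1, congrArg Prod.snd (hf ρ hρ).2.2⟩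
  have hT₁ := hB₁₀.subst g fun ρ hρ =>
    ⟨(hg ρ hρ).1, (hg ρ hρ).2.1, congrArg Prod.fst (hg ρ hρ).2.2⟩
  have hT₂ := hB₂₀.subst g fun ρ hρ =>
    ⟨(hg ρ hρ).1, (hg ρ hρ).2.1, congrArg Prod.snd (hg ρ hρ).2.2⟩
  rw [← hbind'] at hA₁ hA₂ hA₁' hA₂'
  have htyp : Typing φ (Φ.bind H) (M'.toCtx.cons (.box I ⟨A₁, A₂⟩)) W t.erase
      (.box .one ⟨B₁, B₂⟩) := by
    rw [← hbind] at hfin hnode hM' hrec hW hbody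
    exact ht.typing hfin (fun ρ hρ => (hnode ρ hρ).1) (M := M'.cons _) (hM'.cons hrec) hW hbody
  refine ⟨M, _, _, .fix rfl htyp ⟨hA₁.sub hA₁', hA₂'.sub hA₂⟩ hMM, hM, fun ρ hρ => ?_,
    ⟨hK, hT₁, hT₂⟩⟩
  refine ⟨_, _, hH ρ hρ, Idx.hasValue_sum (hH ρ hρ)
    fun a ha => hW _ (cons_mem_extend.2 ⟨hρ, ha⟩), ?_⟩
  rw [hw ρ hρ]
  exact congrArg _ (sum_range_getD (ns ρ) default Node.weight).symm

/-- Every term is uniform. -/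
theorem TTerm.uniform (hU : φ.Universal) {Γ : List PTy} {α : PTy} (t : TTerm Γ α) :
    Uniform φ t := by
  induction t with
  | var x => exact uniform_var hU x
  | num n => exact uniform_num hU n
  | lam t ih => exact uniform_lam hU ih
  | fix t ih => exact uniform_fix hU ih
  | app t u ih ih' => exact uniform_app hU ih ih'
  | succ t ih => exact uniform_succ hU ih
  | pred t ih => exact uniform_pred hU ih
  | ifz t u s ih ih' ih'' => exact uniform_ifz hU ih ih' ih''

/-! ### Sums of derivations for environments -/

theorem isSum_append {α : PTy} {l₁ l₂ : List α.Sem} {s₁ s₂ s : α.Sem} (h₁ : IsSum α l₁ s₁)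
    (h₂ : IsSum α l₂ s₂) (h : IsSum α [s₁, s₂] s) : IsSum α (l₁ ++ l₂) s := by
  cases α with
  | nat =>
    obtain rfl : s₁ = s := h s₁ (by simp)
    obtain rfl : s₂ = s₁ := h s₂ (by simp)
    exact fun x hx => (List.mem_append.1 hx).elim (h₁ x) (h₂ x)
  | arr α β =>
    cases h₁
    cases h₂
    cases h
    exact (congrArg _ (List.append_nil _)).trans List.flatten_append.symm

theorem isSum_singleton {α : PTy} (s : α.Sem) : IsSum α [s] s := by
  cases α with
  | nat => exact fun x hx => List.mem_singleton.1 hx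
  | arr α β => exact (List.append_nil _).symm

theorem SCtx.IsSum.append {Γ : List PTy} {Gs₁ Gs₂ : List (SCtx Γ)} {G₁ G₂ G : SCtx Γ}
    (h₁ : SCtx.IsSum Gs₁ G₁) (h₂ : SCtx.IsSum Gs₂ G₂) (h : SCtx.IsSum [G₁, G₂] G) :
    SCtx.IsSum (Gs₁ ++ Gs₂) G := fun α x => by
  rw [List.map_append]
  exact isSum_append (h₁ α x) (h₂ α x) (h α x)

theorem SCtx.isSum_singleton {Γ : List PTy} (G : SCtx Γ) : SCtx.IsSum [G] G :=
  fun _ _ => DlPCF.isSum_singleton _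

/-- The context `G` without its variable `0`. -/
def SCtx.tail {Γ : List PTy} {α : PTy} (G : SCtx (α :: Γ)) : SCtx Γ := fun _ x => G _ x.succ

theorem SCtx.cons_tail {Γ : List PTy} {α : PTy} (G : SCtx (α :: Γ)) :
    SCtx.cons (G _ .zero) G.tail = G := by
  funext β x
  cases x <;> rfl

/-- Points of a value can be added: the derivations for the copies of an abstraction are
concatenated, and so are the forests of derivations for a fixpoint. -/
theorem TTerm.Deriv.add {Γ : List PTy} {α : PTy} {v : TTerm Γ α} (hv : v.erase.IsValue)
    {G₁ G₂ G : SCtx Γ} {w₁ w₂ : ℕ} {s₁ s₂ : α.Sem} (h₁ : v.Deriv G₁ w₁ s₁)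
    (h₂ : v.Deriv G₂ w₂ s₂) (hG : SCtx.IsSum [G₁, G₂] G) :
    ∃ s, IsSum α [s₁, s₂] s ∧ v.Deriv G (w₁ + w₂) s := by
  cases v with
  | num n =>
    obtain ⟨rfl, rfl⟩ := h₁
    obtain ⟨rfl, rfl⟩ := h₂
    exact ⟨_, by simp [IsSum], rfl, rfl⟩
  | lam t =>
    obtain ⟨ns₁, hns₁, hG₁, rfl⟩ := h₁
    obtain ⟨ns₂, hns₂, hG₂, rfl⟩ := h₂
    refine ⟨List.append s₁ s₂, congrArg (List.append s₁) (List.append_nil s₂).symm, ns₁ ++ ns₂,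
      ?_, ?_, ?_⟩
    · exact List.rel_append hns₁ hns₂
    · rw [List.map_append]
      exact hG₁.append hG₂ hG
    · simp only [List.length_append, List.map_append, List.sum_append]
      omega
  | fix t =>
    obtain ⟨ns₁, hns₁, hG₁, rfl⟩ := h₁
    obtain ⟨ns₂, hns₂, hG₂, rfl⟩ := h₂
    refine ⟨List.append s₁ s₂, congrArg (List.append s₁) (List.append_nil s₂).symm, ns₁ ++ ns₂,
      ?_, ?_, ?_⟩
    · exact hns₁.append hns₂
    · rw [List.map_append]
      exact hG₁.append hG₂ hG
    · simp only [List.length_append, List.map_append, List.sum_append]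
      omega
  | _ => cases hv

/-- A value that is not used has weight `0`. -/
theorem TTerm.exists_deriv_zero {Γ : List PTy} {α : PTy} {v : TTerm Γ α} (hv : v.erase.IsValue)
    {G : SCtx Γ} (hG : SCtx.IsSum [] G) : ∃ s, IsSum α [] s ∧ v.Deriv G 0 s := by
  cases v with
  | num n => exact ⟨n, by simp [IsSum], rfl, rfl⟩
  | lam t => exact ⟨_, rfl, [], .nil, hG, rfl⟩
  | fix t => exact ⟨_, rfl, [], .nil, hG, rfl⟩
  | _ => cases hv

/-- Environments of typed closures of values. -/
inductive TEnv : List PTy → Type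
  | nil : TEnv []
  | cons {Δ Γ : List PTy} {α : PTy} (v : TTerm Δ α) (hv : v.erase.IsValue) (ζ : TEnv Δ)
      (ξ : TEnv Γ) : TEnv (α :: Γ)

def TEnv.erase : {Γ : List PTy} → TEnv Γ → Env
  | _, .nil => .empty
  | _, .cons v _ ζ ξ => .cons v.erase ζ.erase ξ.erase

/-- The closures of an environment have the points that a semantic context assigns to the
variables, with the given total weight. -/
def TEnv.Deriv : {Γ : List PTy} → TEnv Γ → SCtx Γ → ℕ → Prop
  | _, .nil, _, w => w = 0
  | _, .cons v _ ζ ξ, G, w => ∃ G' a b c, v.Deriv G' a (G _ .zero) ∧ ζ.Deriv G' b ∧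
      ξ.Deriv G.tail c ∧ w = a + b + c

/-- The closure `⟨t; ξ⟩` has the point `s`, with weight `w`. -/
def ClosureDeriv {Γ : List PTy} {α : PTy} (t : TTerm Γ α) (ξ : TEnv Γ) (w : ℕ) (s : α.Sem) :
    Prop :=
  ∃ G a b, t.Deriv G a s ∧ ξ.Deriv G b ∧ w = a + b

/-- This undoes the duplication of an environment. -/
theorem TEnv.Deriv.add {Γ : List PTy} {ξ : TEnv Γ} {G₁ G₂ : SCtx Γ} {w₁ w₂ : ℕ}
    (h₁ : ξ.Deriv G₁ w₁) (h₂ : ξ.Deriv G₂ w₂) :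
    ∃ G, SCtx.IsSum [G₁, G₂] G ∧ ξ.Deriv G (w₁ + w₂) := by
  induction ξ generalizing w₁ w₂ with
  | nil =>
    obtain rfl := h₁
    obtain rfl := h₂
    exact ⟨G₁, (fun _ x => nomatch x), rfl⟩
  | cons v hv ζ ξ ihζ ihξ =>
    obtain ⟨G₁', a₁, b₁, c₁, hv₁, hζ₁, hξ₁, rfl⟩ := h₁
    obtain ⟨G₂', a₂, b₂, c₂, hv₂, hζ₂, hξ₂, rfl⟩ := h₂
    obtain ⟨G', hG', hζ⟩ := ihζ hζ₁ hζ₂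
    obtain ⟨G, hG, hξ⟩ := ihξ hξ₁ hξ₂
    obtain ⟨s, hs, hv'⟩ := hv₁.add hv hv₂ hG'
    refine ⟨G.cons s, fun α x => ?_, G', _, _, _, hv', hζ, hξ, by omega⟩
    cases x with
    | zero => exact hs
    | succ x => exact hG _ x

/-- An environment that is not used has weight `0`. -/
theorem TEnv.exists_deriv_zero {Γ : List PTy} (ξ : TEnv Γ) :
    ∃ G, SCtx.IsSum [] G ∧ ξ.Deriv G 0 := by
  induction ξ with
  | nil => exact ⟨default, (fun _ x => nomatch x), rfl⟩
  | cons v hv ζ ξ ihζ ihξ =>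
    obtain ⟨G', hG', hζ⟩ := ihζ
    obtain ⟨G, hG, hξ⟩ := ihξ
    obtain ⟨s, hs, hv'⟩ := TTerm.exists_deriv_zero hv hG'
    refine ⟨G.cons s, fun α x => ?_, G', _, _, _, hv', hζ, hξ, rfl⟩
    cases x with
    | zero => exact hs
    | succ x => exact hG _ x

/-- A derivation for the closure that an environment assigns to `x` is one for the environment. -/
theorem TEnv.exists_lookup {Γ : List PTy} {α : PTy} (ξ : TEnv Γ) (x : Var Γ α) :
    ∃ (Δ : List PTy) (v : TTerm Δ α) (ζ : TEnv Δ),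
      ξ.erase.lookup x.toNat = some ⟨v.erase, ζ.erase⟩ ∧
      ∀ w s, ClosureDeriv v ζ w s → ∃ G : SCtx Γ, G α x = s ∧ ξ.Deriv G w := by
  induction x with
  | zero =>
    cases ξ with
    | cons v hv ζ ξ =>
      refine ⟨_, v, ζ, rfl, ?_⟩
      rintro _ s ⟨G', a, b, hv', hζ, rfl⟩
      obtain ⟨G, -, hG⟩ := ξ.exists_deriv_zero
      exact ⟨G.cons s, rfl, G', a, b, 0, hv', hζ, hG, rfl⟩
  | succ x ih =>
    cases ξ with
    | cons v hv ζ ξ =>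
      obtain ⟨Δ, v', ζ', hl, h⟩ := ih ξ
      refine ⟨Δ, v', ζ', hl, fun w s hs => ?_⟩
      obtain ⟨G, hG, hξ⟩ := h w s hs
      obtain ⟨G', hG', hζ⟩ := ζ.exists_deriv_zero
      obtain ⟨r, -, hr⟩ := TTerm.exists_deriv_zero hv hG'
      exact ⟨G.cons r, hG, G', 0, 0, w, hr, hζ, hξ, by omega⟩

/-! ### Subject expansion for the machine -/

/-- Typed stacks; the type is that of the closures they accept. -/
inductive TStack : PTy → Type
  | nil : TStack .nat
  | fn {Γ : List PTy} {α β : PTy} (v : TTerm Γ (.arr α β)) (hv : v.erase.IsValue) (ξ : TEnv Γ)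
      (π : TStack β) : TStack α
  | arg {Γ : List PTy} {α β : PTy} (u : TTerm Γ α) (ξ : TEnv Γ) (π : TStack β) :
      TStack (.arr α β)
  | fork {Γ : List PTy} {α : PTy} (t u : TTerm Γ α) (ξ : TEnv Γ) (π : TStack α) : TStack .nat
  | succ (π : TStack .nat) : TStack .nat
  | pred (π : TStack .nat) : TStack .nat

def TStack.erase : {α : PTy} → TStack α → Stack
  | _, .nil => .nil
  | _, .fn v _ ξ π => .fn ⟨v.erase, ξ.erase⟩ π.erase
  | _, .arg u ξ π => .arg ⟨u.erase, ξ.erase⟩ π.erase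
  | _, .fork t u ξ π => .fork t.erase u.erase ξ.erase π.erase
  | _, .succ π => .succ π.erase
  | _, .pred π => .pred π.erase

/-- `π.Deriv m w s`: with weight `w`, the stack `π` takes a closure with the point `s` to the
numeral `m`. -/
def TStack.Deriv (m : ℕ) : {α : PTy} → TStack α → ℕ → α.Sem → Prop
  | _, .nil, w, s => w = 0 ∧ s = m
  | _, .fn (β := β) v _ ξ π, w, s => ∃ (r : β.Sem) (a b : ℕ),
      ClosureDeriv v ξ a (PTy.Sem.single (s, r)) ∧ π.Deriv m b r ∧ w = a + b
  | _, .arg (α := α) (β := β) u ξ π, w, s => ∃ (p : α.Sem) (r : β.Sem) (a b : ℕ),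
      s = PTy.Sem.single (p, r) ∧ ClosureDeriv u ξ a p ∧ π.Deriv m b r ∧ w = a + b
  | _, .fork (α := α) t u ξ π, w, s => ∃ (r : α.Sem) (a b : ℕ),
      (s = (0 : ℕ) → ClosureDeriv t ξ a r) ∧ (s ≠ (0 : ℕ) → ClosureDeriv u ξ a r) ∧
      π.Deriv m b r ∧ w = a + b
  | _, .succ π, w, s => π.Deriv m w (Nat.succ s)
  | _, .pred π, w, s => π.Deriv m w (Nat.pred s)

/-- The state `⟨t; ξ⟩ ⋆ π` is derivable with weight `w` and result `m`. -/
def StateDeriv (m : ℕ) {Γ : List PTy} {α : PTy} (t : TTerm Γ α) (ξ : TEnv Γ) (π : TStack α)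
    (w : ℕ) : Prop :=
  ∃ s a b, ClosureDeriv t ξ a s ∧ π.Deriv m b s ∧ w = a + b

section StepInversion

variable {ξ ζ : Env} {π : Stack} {Q : State} {v t u s : Term}

theorem Step.of_var {x : ℕ} (h : Step ⟨⟨.var x, ξ⟩, π⟩ Q) :
    ∃ c, ξ.lookup x = some c ∧ Q = ⟨c, π⟩ := by
  cases h with
  | var h => exact ⟨_, h, rfl⟩
  | _ => cases ‹Term.IsValue _›

theorem Step.of_app (h : Step ⟨⟨.app t u, ξ⟩, π⟩ Q) : Q = ⟨⟨t, ξ⟩, .arg ⟨u, ξ⟩ π⟩ := by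
  cases h <;> first | rfl | cases ‹Term.IsValue _›

theorem Step.of_succ (h : Step ⟨⟨.succ t, ξ⟩, π⟩ Q) : Q = ⟨⟨t, ξ⟩, .succ π⟩ := by
  cases h <;> first | rfl | cases ‹Term.IsValue _›

theorem Step.of_pred (h : Step ⟨⟨.pred t, ξ⟩, π⟩ Q) : Q = ⟨⟨t, ξ⟩, .pred π⟩ := by
  cases h <;> first | rfl | cases ‹Term.IsValue _›

theorem Step.of_ifz (h : Step ⟨⟨.ifz t u s, ξ⟩, π⟩ Q) : Q = ⟨⟨t, ξ⟩, .fork u s ξ π⟩ := by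
  cases h <;> first | rfl | cases ‹Term.IsValue _›

theorem Step.not_of_value_nil (hv : v.IsValue) : ¬ Step ⟨⟨v, ξ⟩, .nil⟩ Q := by
  intro h
  cases h <;> cases hv

theorem Step.of_value_arg (hv : v.IsValue) {c : Closure} (h : Step ⟨⟨v, ξ⟩, .arg c π⟩ Q) :
    Q = ⟨c, .fn ⟨v, ξ⟩ π⟩ := by
  cases h with
  | val_arg => rfl
  | _ => cases hv

theorem Step.of_value_lam (hv : v.IsValue) (h : Step ⟨⟨v, ξ⟩, .fn ⟨.lam t, ζ⟩ π⟩ Q) :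
    Q = ⟨⟨t, .cons v ξ ζ⟩, π⟩ := by
  cases h with
  | val_lam => rfl
  | _ => cases hv

theorem Step.of_value_fix (hv : v.IsValue) (h : Step ⟨⟨v, ξ⟩, .fn ⟨.fix t, ζ⟩ π⟩ Q) :
    Q = ⟨⟨t, .cons (.fix t) ζ ζ⟩, .arg ⟨v, ξ⟩ π⟩ := by
  cases h with
  | val_fix => rfl
  | _ => cases hv

theorem Step.of_num_fork {n : ℕ} (h : Step ⟨⟨.num n, ξ⟩, .fork t u ζ π⟩ Q) :
    Q = ⟨⟨if n = 0 then t else u, ζ⟩, π⟩ := by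
  cases h <;> rfl

theorem Step.of_num_succ {n : ℕ} (h : Step ⟨⟨.num n, ξ⟩, .succ π⟩ Q) :
    Q = ⟨⟨.num (n + 1), .empty⟩, π⟩ := by
  cases h; rfl

theorem Step.of_num_pred {n : ℕ} (h : Step ⟨⟨.num n, ξ⟩, .pred π⟩ Q) :
    Q = ⟨⟨.num (n - 1), .empty⟩, π⟩ := by
  cases h; rfl

end StepInversion

theorem ClosureDeriv.num {Γ : List PTy} (n : ℕ) (ξ : TEnv Γ) :
    ClosureDeriv (.num n) ξ 0 n := by
  obtain ⟨G, -, hG⟩ := ξ.exists_deriv_zero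
  exact ⟨G, 0, 0, ⟨rfl, rfl⟩, hG, rfl⟩

theorem ClosureDeriv.of_num {Γ : List PTy} {n w : ℕ} {ξ : TEnv Γ} {s : PTy.nat.Sem}
    (h : ClosureDeriv (.num n) ξ w s) : s = n := by
  obtain ⟨G, a, b, ⟨-, h⟩, -⟩ := h
  exact h

/-- Expansion along a call of an abstraction: the call adds `1` to the weight. -/
theorem StateDeriv.expand_lam {m : ℕ} {Γ Δ : List PTy} {α β : PTy} {v : TTerm Δ α}
    {hv : v.erase.IsValue} {ζ : TEnv Δ} {t : TTerm (α :: Γ) β} {ht : t.lam.erase.IsValue}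
    {ξ : TEnv Γ} {π : TStack β} {w : ℕ} (h : StateDeriv m t (.cons v hv ζ ξ) π w) :
    StateDeriv m v ζ (.fn t.lam ht ξ π) (w + 1) := by
  obtain ⟨r, _, b, ⟨G, c, _, htr, ⟨G', d, e, f, hv', hζ, hξ, rfl⟩, rfl⟩, hπ, rfl⟩ := h
  refine ⟨_, _, _, ⟨G', d, e, hv', hζ, rfl⟩,
    ⟨r, _, _, ⟨G.tail, 1 + c, f, ⟨[(G.tail, c)], .cons ?_ .nil, G.tail.isSum_singleton, ?_⟩, hξ,
      rfl⟩, hπ, rfl⟩, by omega⟩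
  · rw [SCtx.cons_tail]
    exact htr
  · simp

/-- Expansion along a call of a fixpoint: the derivation for the body becomes the root of a new
tree, above the forest of the recursive calls. -/
theorem StateDeriv.expand_fix {m : ℕ} {Γ Δ : List PTy} {α β : PTy} {v : TTerm Δ α}
    {ζ : TEnv Δ} {t : TTerm (.arr α β :: Γ) (.arr α β)} {ht : t.fix.erase.IsValue}
    {ξ : TEnv Γ} {π : TStack β} {w : ℕ} (h : StateDeriv m t (.cons t.fix ht ξ ξ) (.arg v ζ π) w) :
    StateDeriv m v ζ (.fn t.fix ht ξ π) (w + 1) := by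
  obtain ⟨_, _, _, ⟨G, c, _, htr, ⟨G', d, e, f, ⟨ns, hns, hG', rfl⟩, hξ', hξ, rfl⟩, rfl⟩,
    ⟨p, r, a, b, rfl, hv, hπ, rfl⟩, rfl⟩ := h
  obtain ⟨G₀, hG₀, hξ₀⟩ := hξ.add hξ'
  refine ⟨p, a, _, hv, ⟨r, _, b, ⟨G₀, c + 1 + (ns.length + (ns.map Node.weight).sum), _,
    ⟨_, IsForest.cons (ν := ⟨G _ .zero, (p, r), G.tail, c⟩) (l := []) ?_ hns .nil, ?_, ?_⟩, hξ₀,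
      rfl⟩, hπ, rfl⟩, by omega⟩
  · exact (SCtx.cons_tail G).symm ▸ htr
  · rw [List.append_nil]
    exact (SCtx.isSum_singleton G.tail).append hG' hG₀
  · simp only [List.append_nil, List.length_cons, List.map_cons, List.sum_cons]
    omega

/-- Weighted subject expansion: a terminating run makes its initial state derivable, with a weight
that counts only the calls of functions among its transitions. -/
theorem StateDeriv.of_steps {m n : ℕ} {Γ : List PTy} {α : PTy} {t : TTerm Γ α} {ξ : TEnv Γ}
    {π : TStack α} {ξ' : Env}
    (h : Steps n ⟨⟨t.erase, ξ.erase⟩, π.erase⟩ ⟨⟨.num m, ξ'⟩, .nil⟩) :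
    ∃ w ≤ n, StateDeriv m t ξ π w := by
  induction n generalizing Γ α with
  | zero =>
    generalize hP : (⟨⟨t.erase, ξ.erase⟩, π.erase⟩ : State) = P at h
    cases h
    simp only [State.mk.injEq, Closure.mk.injEq] at hP
    obtain ⟨⟨ht, -⟩, hπ⟩ := hP
    cases t <;> simp only [TTerm.erase, reduceCtorEq, Term.num.injEq] at ht
    subst ht
    cases π <;> simp only [TStack.erase, reduceCtorEq] at hπ
    exact ⟨0, le_rfl, _, 0, 0, .num _ ξ, ⟨rfl, rfl⟩, rfl⟩
  | succ n ih =>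
    -- at a value, the transition is determined by the stack
    have step_value : t.erase.IsValue → ∃ w ≤ n + 1, StateDeriv m t ξ π w := by
      intro hv
      obtain _ | ⟨hs, h⟩ := h
      cases π with
      | nil => exact (Step.not_of_value_nil hv hs).elim
      | fn f hf ζ π =>
        cases f with
        | lam f =>
          obtain rfl := Step.of_value_lam hv hs
          obtain ⟨w, hw, hD⟩ := ih (t := f) (ξ := .cons t hv ξ ζ) h
          exact ⟨w + 1, by omega, hD.expand_lam⟩
        | fix f =>
          obtain rfl := Step.of_value_fix hv hs
          obtain ⟨w, hw, hD⟩ := ih (t := f) (ξ := .cons f.fix hf ζ ζ) (π := .arg t ξ π) h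
          exact ⟨w + 1, by omega, hD.expand_fix⟩
        | _ => cases hf
      | arg u ζ π =>
        obtain rfl := Step.of_value_arg hv hs
        obtain ⟨w, hw, p, a, _, hu, ⟨r, c, d, ht, hπ, rfl⟩, rfl⟩ := ih (π := .fn t hv ξ π) h
        exact ⟨a + (c + d), by omega, _, c, a + d, ht, ⟨p, r, a, d, rfl, hu, hπ, rfl⟩, by omega⟩
      | fork u₁ u₂ ζ π =>
        cases t with
        | num i =>
          obtain rfl := Step.of_num_fork hs
          have hi : (if i = 0 then u₁ else u₂).erase = if i = 0 then u₁.erase else u₂.erase := by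
            split_ifs <;> rfl
          obtain ⟨w, hw, r, a, b, hu, hπ, rfl⟩ := ih (t := if i = 0 then u₁ else u₂) (hi ▸ h)
          refine ⟨a + b, by omega, i, 0, a + b, .num i ξ,
            ⟨r, a, b, fun (h0 : i = 0) => ?_, fun (h0 : i ≠ 0) => ?_, hπ, rfl⟩, by omega⟩
          · rwa [if_pos h0] at hu
          · rwa [if_neg h0] at hu
        | _ => cases hv
      | succ π =>
        cases t with
        | num i =>
          obtain rfl := Step.of_num_succ hs
          have hnil : (TEnv.nil.erase : Env) = .empty := rfl
          obtain ⟨w, hw, s, a, b, hu, hπ, rfl⟩ :=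
            ih (t := .num (i + 1)) (ξ := .nil) (π := π) (hnil ▸ h)
          obtain rfl := hu.of_num
          exact ⟨b, by omega, i, 0, b, .num i ξ, hπ, by omega⟩
        | _ => cases hv
      | pred π =>
        cases t with
        | num i =>
          obtain rfl := Step.of_num_pred hs
          have hnil : (TEnv.nil.erase : Env) = .empty := rfl
          obtain ⟨w, hw, s, a, b, hu, hπ, rfl⟩ :=
            ih (t := .num (i - 1)) (ξ := .nil) (π := π) (hnil ▸ h)
          obtain rfl := hu.of_num
          exact ⟨b, by omega, i, 0, b, .num i ξ, hπ, by omega⟩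
        | _ => cases hv
    cases t with
    | num i => exact step_value (.num i)
    | lam t => exact step_value (.lam _)
    | fix t => exact step_value (.fix _)
    | var x =>
      obtain _ | ⟨hs, h⟩ := h
      obtain ⟨c, hc, rfl⟩ := Step.of_var hs
      obtain ⟨Δ, v, ζ, hl, hζ⟩ := ξ.exists_lookup x
      obtain rfl := Option.some.inj (hc.symm.trans hl)
      obtain ⟨w, hw, s, a, b, hv, hπ, rfl⟩ := ih h
      obtain ⟨G, hG, hξ⟩ := hζ a s hv
      exact ⟨_, by omega, s, a, b, ⟨G, 0, a, ⟨rfl, hG⟩, hξ, by omega⟩, hπ, rfl⟩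
    | app t u =>
      obtain _ | ⟨hs, h⟩ := h
      obtain rfl := Step.of_app hs
      obtain ⟨w, hw, _, _, _, ⟨G₁, a, b, ht, hξ₁, rfl⟩,
        ⟨p, r, _, d, rfl, ⟨G₂, e, f, hu, hξ₂, rfl⟩, hπ, rfl⟩, rfl⟩ := ih (π := .arg u ξ π) h
      obtain ⟨G, hG, hξ⟩ := hξ₁.add hξ₂
      exact ⟨a + b + (e + f + d), by omega, r, _, d,
        ⟨G, a + e, _, ⟨p, G₁, G₂, a, e, ht, hu, hG, rfl⟩, hξ, rfl⟩, hπ,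
        by omega⟩
    | succ t =>
      obtain _ | ⟨hs, h⟩ := h
      obtain rfl := Step.of_succ hs
      obtain ⟨w, hw, i, _, _, ⟨G, a, b, ht, hξ, rfl⟩, hπ, rfl⟩ := ih (π := .succ π) h
      exact ⟨_, by omega, _, _, _, ⟨G, a, b, ⟨i, ht, rfl⟩, hξ, rfl⟩, hπ, rfl⟩
    | pred t =>
      obtain _ | ⟨hs, h⟩ := h
      obtain rfl := Step.of_pred hs
      obtain ⟨w, hw, i, _, _, ⟨G, a, b, ht, hξ, rfl⟩, hπ, rfl⟩ := ih (π := .pred π) h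
      exact ⟨_, by omega, _, _, _, ⟨G, a, b, ⟨i, ht, rfl⟩, hξ, rfl⟩, hπ, rfl⟩
    | ifz t u₁ u₂ =>
      obtain _ | ⟨hs, h⟩ := h
      obtain rfl := Step.of_ifz hs
      obtain ⟨w, hw, i, _, _, ⟨G₁, a, b, ht, hξ₁, rfl⟩, ⟨r, c, d, h0, h1, hπ, rfl⟩, rfl⟩ :=
        ih (π := .fork u₁ u₂ ξ π) h
      obtain ⟨G₂, e, f, hu₁, hu₂, hξ₂, rfl⟩ : ∃ G₂ e f, (i = (0 : ℕ) → u₁.Deriv G₂ e r) ∧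
          (i ≠ (0 : ℕ) → u₂.Deriv G₂ e r) ∧ ξ.Deriv G₂ f ∧ c = e + f := by
        by_cases hi : i = (0 : ℕ)
        · obtain ⟨G₂, e, f, hu, hξ, rfl⟩ := h0 hi
          exact ⟨G₂, e, f, fun _ => hu, fun h => (h hi).elim, hξ, rfl⟩
        · obtain ⟨G₂, e, f, hu, hξ, rfl⟩ := h1 hi
          exact ⟨G₂, e, f, fun h => (hi h).elim, fun _ => hu, hξ, rfl⟩
      obtain ⟨G, hG, hξ⟩ := hξ₁.add hξ₂
      exact ⟨a + b + (e + f + d), by omega, r, _, d,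
        ⟨G, a + e, _, ⟨i, G₁, G₂, a, e, ht, hu₁, hu₂, hG, rfl⟩, hξ,
        rfl⟩, hπ, by omega⟩

end DlPCF

theorem mainTheorem3 {Θ : ℕ → Type*} (E : DlPCF.EqProgram Θ) (φ : DlPCF.Interp Θ)
    (hE : φ.Models E) (hU : φ.Universal) (t : DlPCF.Term) (n m : ℕ)
    (ht : DlPCF.PCFTyping [] t .nat) (hev : t.EvalsTo n m) :
    ∃ k ≤ n, DlPCF.Typing φ ([] : DlPCF.ICtx Θ 0) DlPCF.Ctx.empty (.numeral k) t
      (.nat (.numeral m) (.numeral m)) := by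
  obtain ⟨t, rfl⟩ := ht.exists_erase_eq
  obtain ⟨ξ, hsteps⟩ := hev
  obtain ⟨w, hw, _, _, _, ⟨G, a, b, hd, hb, rfl⟩, ⟨rfl, rfl⟩, rfl⟩ :=
    DlPCF.StateDeriv.of_steps (t := t) (ξ := .nil) (π := .nil) hsteps
  obtain rfl : b = 0 := hb
  refine ⟨a, hw, ?_⟩
  -- without index variables there is only one assignment, hence a finite family of derivations
  exact (DlPCF.TTerm.uniform hU t).typing (Set.toFinite _) (fun _ _ => hd)
    (M := fun _ x => nomatch x) (fun _ x => nomatch x)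
    (fun ρ _ => DlPCF.Idx.hasValue_numeral a ρ)
    (fun ρ _ => ⟨DlPCF.Idx.hasValue_numeral _ ρ, DlPCF.Idx.hasValue_numeral _ ρ⟩)
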